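/- Let $M$ be a smooth manifold with a smooth Riemannian metric $g$ and a foliation $\mathcal F$ of dimension $p$ and codimension $n$; let $\mathcal D = T\mathcal F$, let $\mathcal D^\perp$ be its $g$-orthogonal complement, let $X = X^\top + X^\perp$ be the decomposition of vectors along $TM = \mathcal D \oplus \mathcal D^\perp$, and let $g = g_{\mathcal F} + g^\perp$ with $g_{\mathcal F}(X,Y) = g(X^\top,Y^\top)$, $g^\perp(X,Y) = g(X^\perp,Y^\perp)$. Let $\nabla$ be the Levi-Civita connection of $g$ and $R(X,Y) = \nabla_Y\nabla_X - \nabla_X\nabla_Y + \nabla_{[X,Y]}$. For $g$-orthonormal bases $E_1,\dots,E_p$ of $\mathcal D_x$ and $\mathcal E_1,\dots,\mathcal E_n$ of $\mathcal D^\perp_x$ define the following quantities (which do not depend on the choice of the bases). The mixed scalar curvature is $S_{\rm mix} = \sum_{j=1}^n\sum_{a=1}^p g(R(\mathcal E_j,E_a)\mathcal E_j,E_a)$. The second fundamental form of the leaves is $h(X,Y) = (\nabla_X Y)^\perp$ for $X,Y$ tangent to $\mathcal D$, with $H = \sum_a h(E_a,E_a)$ and $\|h\|_g^2 = \sum_{a,b}\|h(E_a,E_b)\|_g^2$.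 For $X,Y$ tangent to $\mathcal D^\perp$ let $h^\perp(X,Y) = \frac12(\nabla_XY+\nabla_YX)^\top$ and $T(X,Y) = \frac12[X,Y]^\top$, with $H^\perp = \sum_j h^\perp(\mathcal E_j,\mathcal E_j)$ and $\|T\|_g^2 = \sum_{i,j}\|T(\mathcal E_i,\mathcal E_j)\|_g^2$. The leafwise Laplacian of $u\in C^\infty(M)$ is $\Delta^\top u = \sum_a g(\nabla_{E_a}\nabla^\top u,E_a)$, where $\nabla^\top u = (\nabla u)^\top$ is the leafwise gradient. Suppose that $\mathcal F$ is harmonic, i.e. $H = 0$ on $M$. Let $u$ be a smooth positive function on $M$, let $\tilde g = g_{\mathcal F} + u^2 g^\perp$, and let $\tilde S_{\rm mix}$ be the mixed scalar curvature of $\mathcal F$ with respect to the metric $\tilde g$. Then, everywhere on $M$, $$(S_{\rm mix} - \tilde S_{\rm mix})\,u = n\,\Delta^\top u - 2H^\perp(u) + \|h\|_g^2\,(u^{-1} - u) - \|T\|_g^2\,(u^{-3} - u).$$ If, in particular, $u$ is constant on every leaf of $\mathcal F$, then, everywhere on $M$, $$\tilde S_{\rm mix} = S_{\rm mix} - (u^{-2}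 - 1)\|h\|_g^2 + (u^{-4} - 1)\|T\|_g^2.$$ -/

import Mathlib

open Bundle Manifold VectorField
open scoped ContDiff Topology

noncomputable section

/-- A `p`-dimensional foliation of codimension `n` of a manifold `M` (modelled on `E`), given by an
atlas of smooth charts with values in `ℝ^p × ℝ^n` covering `M`, whose plaques (the slices on which
the transverse coordinate is constant) are connected, and whose changes of coordinates are locally
of the form `(a, b) ↦ (φ (a, b), ψ b)`. -/
structure Foliation (p n : ℕ) (E : Type*) [NormedAddCommGroup E] [NormedSpace ℝ E]
    (M : Type*) [TopologicalSpace M] [ChartedSpace E M] where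
  /-- the foliated charts -/
  atlas : Set (OpenPartialHomeomorph M (EuclideanSpace ℝ (Fin p) × EuclideanSpace ℝ (Fin n)))
  contMDiffOn_toFun : ∀ e ∈ atlas, ContMDiffOn 𝓘(ℝ, E)
    𝓘(ℝ, EuclideanSpace ℝ (Fin p) × EuclideanSpace ℝ (Fin n)) ∞ e e.source
  contMDiffOn_symm : ∀ e ∈ atlas, ContMDiffOn
    𝓘(ℝ, EuclideanSpace ℝ (Fin p) × EuclideanSpace ℝ (Fin n)) 𝓘(ℝ, E) ∞ e.symm e.target
  cover : ∀ x : M, ∃ e ∈ atlas, x ∈ e.source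
  plaque_connected : ∀ e ∈ atlas, ∀ b : EuclideanSpace ℝ (Fin n),
    IsPreconnected {a : EuclideanSpace ℝ (Fin p) | (a, b) ∈ e.target}
  compatible : ∀ e ∈ atlas, ∀ e' ∈ atlas, ∀ x ∈ e.source ∩ e'.source,
    ∃ U ∈ 𝓝 x, ∀ y ∈ U, ∀ z ∈ U, (e y).2 = (e z).2 → (e' y).2 = (e' z).2

/-- A Riemannian metric on `M`, as a field of inner products on the tangent spaces (no smoothness is
included). -/
abbrev TangentMetric (E : Type*) [NormedAddCommGroup E] [NormedSpace ℝ E]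
    (M : Type*) [TopologicalSpace M] [ChartedSpace E M] :=
  RiemannianMetric (fun x : M => TangentSpace 𝓘(ℝ, E) x)

theorem exists_tangentBasis {E : Type*} [NormedAddCommGroup E] [NormedSpace ℝ E]
    [FiniteDimensional ℝ E] {M : Type*} [TopologicalSpace M] [ChartedSpace E M]
    (g : TangentMetric E M) (x : M) (W : Submodule ℝ (TangentSpace 𝓘(ℝ, E) x)) :
    ∃ b : Module.Basis (Fin (Module.finrank ℝ W)) ℝ W, ∀ i j,
      g.inner x (b i : TangentSpace 𝓘(ℝ, E) x) (b j : TangentSpace 𝓘(ℝ, E) x)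
        = if i = j then 1 else 0 := by
  let _ : NormedAddCommGroup (TangentSpace 𝓘(ℝ, E) x) :=
    @InnerProductSpace.Core.toNormedAddCommGroup ℝ _ _ _ _ (g.toCore x)
  let _ : InnerProductSpace ℝ (TangentSpace 𝓘(ℝ, E) x) := InnerProductSpace.ofCore (g.toCore x).toCore
  have : FiniteDimensional ℝ (TangentSpace 𝓘(ℝ, E) x) := inferInstanceAs (FiniteDimensional ℝ E)
  refine ⟨(stdOrthonormalBasis ℝ W).toBasis, fun i j => ?_⟩
  have h := (orthonormal_iff_ite.mp (stdOrthonormalBasis ℝ W).orthonormal) i j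
  rw [OrthonormalBasis.coe_toBasis]
  exact h

theorem metric_self_nonneg {E : Type*} [NormedAddCommGroup E] [NormedSpace ℝ E]
    {M : Type*} [TopologicalSpace M] [ChartedSpace E M] (g : TangentMetric E M) (x : M) (v : TangentSpace 𝓘(ℝ, E) x) :
    0 ≤ g.inner x v v := by
  rcases eq_or_ne v 0 with rfl | hv
  · simp
  · exact (g.pos x v hv).le

theorem continuous_diagonal {E : Type*} [NormedAddCommGroup E] [NormedSpace ℝ E]
    (B : E →L[ℝ] E →L[ℝ] ℝ) : Continuous fun v => B v v := by
  fun_prop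

/-- A `g`-orthonormal basis of a subspace `W` of `T_x M`. -/
def tangentBasis {E : Type*} [NormedAddCommGroup E] [NormedSpace ℝ E]
    [FiniteDimensional ℝ E] {M : Type*} [TopologicalSpace M] [ChartedSpace E M]
    (g : TangentMetric E M) (x : M) (W : Submodule ℝ (TangentSpace 𝓘(ℝ, E) x))
    (i : Fin (Module.finrank ℝ W)) : TangentSpace 𝓘(ℝ, E) x :=
  ((exists_tangentBasis g x W).choose i : W)

section Riemannian

variable {E : Type*} [NormedAddCommGroup E] [NormedSpace ℝ E]
  {M : Type*} [TopologicalSpace M] [ChartedSpace E M] [IsManifold 𝓘(ℝ, E) ∞ M]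

/-- The right-hand side of Koszul's formula for `2 g(∇_X Y, Z)` at `x`. -/
def koszul (g : TangentMetric E M)
    (X Y Z : ∀ x : M, TangentSpace 𝓘(ℝ, E) x) (x : M) : ℝ :=
  mvfderiv 𝓘(ℝ, E) (fun y => g.inner y (Y y) (Z y)) x (X x)
    + mvfderiv 𝓘(ℝ, E) (fun y => g.inner y (Z y) (X y)) x (Y x)
    - mvfderiv 𝓘(ℝ, E) (fun y => g.inner y (X y) (Y y)) x (Z x)
    + g.inner x (mlieBracket 𝓘(ℝ, E) X Y x) (Z x)
    - g.inner x (mlieBracket 𝓘(ℝ, E) X Z x) (Y x)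
    - g.inner x (mlieBracket 𝓘(ℝ, E) Y Z x) (X x)

/-- `X` is a vector field that is `C^∞` near `x`. -/
def SmoothFieldAt (X : ∀ x : M, TangentSpace 𝓘(ℝ, E) x) (x : M) : Prop :=
  ContMDiffAt 𝓘(ℝ, E) 𝓘(ℝ, E).tangent ∞ (fun y => (⟨y, X y⟩ : TangentBundle 𝓘(ℝ, E) M)) x

/-- The covariant derivative `∇_v Y` of a vector field `Y` in the direction of `v ∈ T_x M`, for the
Levi-Civita connection of `g`: the vector characterized by Koszul's formula
`2 g(∇_v Y, Z) = koszul g X Y Z` for all smooth vector fields `X`, `Z` near `x` with `X x = v`. -/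
def leviCivita (g : TangentMetric E M) (x : M)
    (v : TangentSpace 𝓘(ℝ, E) x) (Y : ∀ x : M, TangentSpace 𝓘(ℝ, E) x) : TangentSpace 𝓘(ℝ, E) x :=
  Classical.epsilon fun w => ∀ X Z : ∀ x : M, TangentSpace 𝓘(ℝ, E) x,
    SmoothFieldAt X x → SmoothFieldAt Z x → X x = v → 2 * g.inner x w (Z x) = koszul g X Y Z x

/-- The curvature `R(X, Y) Z = ∇_Y ∇_X Z - ∇_X ∇_Y Z + ∇_{[X, Y]} Z` at `x`. -/
def curvature (g : TangentMetric E M)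
    (X Y Z : ∀ x : M, TangentSpace 𝓘(ℝ, E) x) (x : M) : TangentSpace 𝓘(ℝ, E) x :=
  leviCivita g x (Y x) (fun y => leviCivita g y (X y) Z)
    - leviCivita g x (X x) (fun y => leviCivita g y (Y y) Z)
    + leviCivita g x (mlieBracket 𝓘(ℝ, E) X Y x) Z

/-- `K(v, w) = g(R(v, w) v, w)` for `v, w ∈ T_x M`, computed with smooth local extensions of
`v`, `w`; it is the sectional curvature of the plane of `v`, `w` if these are orthonormal. -/
def sectionalCurvature (g : TangentMetric E M) (x : M)
    (v w : TangentSpace 𝓘(ℝ, E) x) : ℝ :=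
  g.inner x (curvature g (FiberBundle.extend E v) (FiberBundle.extend E w)
    (FiberBundle.extend E v) x) w

end Riemannian

namespace Foliation

section Pointwise

variable {p n : ℕ} {E : Type*} [NormedAddCommGroup E] [NormedSpace ℝ E]
  {M : Type*} [TopologicalSpace M] [ChartedSpace E M]

/-- Two points lie in a common plaque. -/
def SamePlaque (F : Foliation p n E M) (x y : M) : Prop :=
  ∃ e ∈ F.atlas, x ∈ e.source ∧ y ∈ e.source ∧ (e x).2 = (e y).2

/-- The leaf through `x`: the points that can be joined to `x` by a finite chain of plaques. -/
def leaf (F : Foliation p n E M) (x : M) : Set M :=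
  {y | Relation.ReflTransGen F.SamePlaque x y}

/-- `u` is constant on every leaf. -/
def IsLeafwiseConstant (F : Foliation p n E M) (u : M → ℝ) : Prop :=
  ∀ x, ∀ y ∈ F.leaf x, u y = u x

/-- The tangent space `D_x` of the leaf through `x`: the vectors that are annihilated by the
differential of the transverse coordinate of the foliated charts around `x`. -/
def tangent (F : Foliation p n E M) (x : M) : Submodule ℝ (TangentSpace 𝓘(ℝ, E) x) :=
  ⨅ e ∈ {e | e ∈ F.atlas ∧ x ∈ e.source},
    (mvfderiv 𝓘(ℝ, E) (fun y => (e y).2) x).toLinearMap.ker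

/-- The orthogonal complement of `D_x` in `T_x M`. -/
def normal (F : Foliation p n E M) (g : TangentMetric E M) (x : M) :
    Submodule ℝ (TangentSpace 𝓘(ℝ, E) x) where
  carrier := {w | ∀ v ∈ F.tangent x, g.inner x v w = 0}
  add_mem' hv hw z hz := by simp [hv z hz, hw z hz]
  zero_mem' z _ := by simp
  smul_mem' c w hw z hz := by simp [hw z hz]

variable [FiniteDimensional ℝ E]

/-- The orthogonal projection `v ↦ v^⊤` of `T_x M` onto `D_x`. -/
def tangentPart (F : Foliation p n E M) (g : TangentMetric E M) (x : M) :
    TangentSpace 𝓘(ℝ, E) x →L[ℝ] TangentSpace 𝓘(ℝ, E) x :=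
  ∑ a, (g.inner x (tangentBasis g x (F.tangent x) a)).smulRight (tangentBasis g x (F.tangent x) a)

/-- The orthogonal projection `v ↦ v^⊥` of `T_x M` onto the orthogonal complement of `D_x`. -/
def normalPart (F : Foliation p n E M) (g : TangentMetric E M) (x : M) :
    TangentSpace 𝓘(ℝ, E) x →L[ℝ] TangentSpace 𝓘(ℝ, E) x :=
  ContinuousLinearMap.id ℝ _ - F.tangentPart g x

theorem metric_self_le (F : Foliation p n E M) (g : TangentMetric E M) (x : M)
    (v : TangentSpace 𝓘(ℝ, E) x) :
    g.inner x v v ≤ 2 * (g.inner x (F.tangentPart g x v) (F.tangentPart g x v)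
      + g.inner x (F.normalPart g x v) (F.normalPart g x v)) := by
  have h : F.tangentPart g x v + F.normalPart g x v = v := by simp [normalPart]
  have h1 := metric_self_nonneg g x (F.tangentPart g x v - F.normalPart g x v)
  have h2 := g.symm x (F.tangentPart g x v) (F.normalPart g x v)
  conv_lhs => rw [← h]
  simp only [map_add, map_sub, add_apply, sub_apply] at h1 ⊢
  linarith

/-- The metric `g_F + u² g^⊥`, where `g_F(v, w) = g(v^⊤, w^⊤)` and `g^⊥(v, w) = g(v^⊥, w^⊥)`. -/
def normalConformal (F : Foliation p n E M) (g : TangentMetric E M) (u : M → ℝ)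
    (hu : ∀ x, 0 < u x) : TangentMetric E M where
  inner x := (ContinuousLinearMap.precomp ℝ (F.tangentPart g x)).comp
      ((g.inner x).comp (F.tangentPart g x))
    + u x ^ 2 • (ContinuousLinearMap.precomp ℝ (F.normalPart g x)).comp
      ((g.inner x).comp (F.normalPart g x))
  symm x v w := by
    simp [g.symm x (F.tangentPart g x v), g.symm x (F.normalPart g x v)]
  pos x v hv := by
    have h := metric_self_le F g x v
    have h1 := g.pos x v hv
    have h2 := metric_self_nonneg g x (F.tangentPart g x v)
    have h3 := metric_self_nonneg g x (F.normalPart g x v)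
    have h4 : 0 < u x ^ 2 := pow_pos (hu x) 2
    simp only [add_apply, ContinuousLinearMap.comp_apply,
      smul_apply, ContinuousLinearMap.precomp_apply, smul_eq_mul]
    rcases h3.eq_or_lt with h5 | h5
    · rw [← h5] at h ⊢
      linarith
    · have := mul_pos h4 h5
      linarith
  continuousAt x := (continuous_diagonal (E := E) _).continuousAt
  isVonNBounded x := by
    have hb := (g.isVonNBounded x).image
      ((2 * (1 + (u x ^ 2)⁻¹)) • ContinuousLinearMap.id ℝ (TangentSpace 𝓘(ℝ, E) x))
    refine hb.subset fun v hv => ?_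
    have h := metric_self_le F g x v
    have h2 := metric_self_nonneg g x (F.tangentPart g x v)
    have h3 := metric_self_nonneg g x (F.normalPart g x v)
    have h4 : 0 < u x ^ 2 := pow_pos (hu x) 2
    simp only [Set.mem_ofPred_eq, add_apply, ContinuousLinearMap.comp_apply,
      smul_apply, ContinuousLinearMap.precomp_apply, smul_eq_mul] at hv
    have h5 : 0 < (u x ^ 2)⁻¹ := inv_pos.mpr h4
    have h6 : g.inner x (F.normalPart g x v) (F.normalPart g x v) < (u x ^ 2)⁻¹ := by
      rw [← one_div, lt_div_iff₀ h4]
      linarith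
    have h7 : g.inner x v v < 2 * (1 + (u x ^ 2)⁻¹) := by
      nlinarith
    have hK : (1 : ℝ) < 2 * (1 + (u x ^ 2)⁻¹) := by linarith
    generalize 2 * (1 + (u x ^ 2)⁻¹) = K at h7 hK ⊢
    have hK0 : 0 < K := by linarith
    refine ⟨K⁻¹ • v, ?_, by simp [hK0.ne']⟩
    simp only [Set.mem_ofPred_eq, map_smul, smul_apply, smul_eq_mul]
    rw [inv_mul_lt_iff₀ hK0, inv_mul_lt_iff₀ hK0]
    nlinarith

/-- The leafwise gradient `∇^⊤ u`. -/
def leafGradient (F : Foliation p n E M) (g : TangentMetric E M) (u : M → ℝ) (x : M) :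
    TangentSpace 𝓘(ℝ, E) x :=
  ∑ a, mvfderiv 𝓘(ℝ, E) u x (tangentBasis g x (F.tangent x) a) • tangentBasis g x (F.tangent x) a

end Pointwise

variable {p n : ℕ} {E : Type*} [NormedAddCommGroup E] [NormedSpace ℝ E] [FiniteDimensional ℝ E]
  {M : Type*} [TopologicalSpace M] [ChartedSpace E M] [IsManifold 𝓘(ℝ, E) ∞ M]

/-- A section of the tangent distribution near `x` that extends `v ∈ D_x`. -/
def tangentExtend (F : Foliation p n E M) (g : TangentMetric E M) {x : M}
    (v : TangentSpace 𝓘(ℝ, E) x) (y : M) : TangentSpace 𝓘(ℝ, E) y :=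
  F.tangentPart g y (FiberBundle.extend E v y)

/-- A section of the normal distribution near `x` that extends a vector `v` normal to `D_x`. -/
def normalExtend (F : Foliation p n E M) (g : TangentMetric E M) {x : M}
    (v : TangentSpace 𝓘(ℝ, E) x) (y : M) : TangentSpace 𝓘(ℝ, E) y :=
  F.normalPart g y (FiberBundle.extend E v y)

/-- The mixed scalar curvature `S_mix = ∑_j ∑_a K(ℰ_j, E_a)`. -/
def mixedScalarCurvature (F : Foliation p n E M) (g : TangentMetric E M) (x : M) : ℝ :=
  ∑ j, ∑ a, sectionalCurvature g x (tangentBasis g x (F.normal g x) j)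
    (tangentBasis g x (F.tangent x) a)

/-- The second fundamental form of the leaves, `h(v, w) = (∇_v W)^⊥` for `v, w ∈ D_x`, where `W` is
a section of the tangent distribution with `W x = w`. -/
def secondFundamentalForm (F : Foliation p n E M) (g : TangentMetric E M) (x : M)
    (v w : TangentSpace 𝓘(ℝ, E) x) : TangentSpace 𝓘(ℝ, E) x :=
  F.normalPart g x (leviCivita g x v (F.tangentExtend g w))

/-- The mean curvature vector `H = ∑_a h(E_a, E_a)` of the leaves. -/
def meanCurvature (F : Foliation p n E M) (g : TangentMetric E M) (x : M) :
    TangentSpace 𝓘(ℝ, E) x :=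
  ∑ a, F.secondFundamentalForm g x (tangentBasis g x (F.tangent x) a)
    (tangentBasis g x (F.tangent x) a)

/-- The foliation is harmonic: its leaves are minimal, `H = 0`. -/
def IsHarmonic (F : Foliation p n E M) (g : TangentMetric E M) : Prop :=
  ∀ x, F.meanCurvature g x = 0

/-- `‖h‖² = ∑_{a, b} ‖h(E_a, E_b)‖²`. -/
def secondFundamentalFormNormSq (F : Foliation p n E M) (g : TangentMetric E M) (x : M) : ℝ :=
  ∑ a, ∑ b,
    g.inner x
      (F.secondFundamentalForm g x (tangentBasis g x (F.tangent x) a)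
        (tangentBasis g x (F.tangent x) b))
      (F.secondFundamentalForm g x (tangentBasis g x (F.tangent x) a)
        (tangentBasis g x (F.tangent x) b))

/-- The second fundamental form of the normal distribution, `2 h^⊥(v, w) = (∇_v W + ∇_w V)^⊤` for
`v, w` normal to `D_x`, where `V`, `W` are sections of the normal distribution extending them. -/
def normalSecondFundamentalForm (F : Foliation p n E M) (g : TangentMetric E M) (x : M)
    (v w : TangentSpace 𝓘(ℝ, E) x) : TangentSpace 𝓘(ℝ, E) x :=
  (1 / 2 : ℝ) • F.tangentPart g x
    (leviCivita g x v (F.normalExtend g w) + leviCivita g x w (F.normalExtend g v))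

/-- The mean curvature vector `H^⊥ = ∑_j h^⊥(ℰ_j, ℰ_j)` of the normal distribution. -/
def normalMeanCurvature (F : Foliation p n E M) (g : TangentMetric E M) (x : M) :
    TangentSpace 𝓘(ℝ, E) x :=
  ∑ j, F.normalSecondFundamentalForm g x (tangentBasis g x (F.normal g x) j)
    (tangentBasis g x (F.normal g x) j)

/-- The integrability tensor of the normal distribution, `2 T(v, w) = [V, W]^⊤` for `v, w` normal to
`D_x`, where `V`, `W` are sections of the normal distribution extending them. -/
def integrabilityTensor (F : Foliation p n E M) (g : TangentMetric E M) (x : M)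
    (v w : TangentSpace 𝓘(ℝ, E) x) : TangentSpace 𝓘(ℝ, E) x :=
  (1 / 2 : ℝ) • F.tangentPart g x
    (mlieBracket 𝓘(ℝ, E) (F.normalExtend g v) (F.normalExtend g w) x)

/-- `‖T‖² = ∑_{i, j} ‖T(ℰ_i, ℰ_j)‖²`. -/
def integrabilityTensorNormSq (F : Foliation p n E M) (g : TangentMetric E M) (x : M) : ℝ :=
  ∑ i, ∑ j,
    g.inner x
      (F.integrabilityTensor g x (tangentBasis g x (F.normal g x) i)
        (tangentBasis g x (F.normal g x) j))
      (F.integrabilityTensor g x (tangentBasis g x (F.normal g x) i)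
        (tangentBasis g x (F.normal g x) j))

/-- The leafwise Laplacian `Δ^⊤ u = div^⊤ (∇^⊤ u) = ∑_a g(∇_{E_a} ∇^⊤ u, E_a)`. -/
def leafLaplacian (F : Foliation p n E M) (g : TangentMetric E M) (u : M → ℝ) (x : M) : ℝ :=
  ∑ a, g.inner x
    (leviCivita g x (tangentBasis g x (F.tangent x) a) (F.leafGradient g u))
    (tangentBasis g x (F.tangent x) a)

end Foliation

end

/-! The proof computes everything in an adapted frame: smooth local orthonormal fields e_a tangent
to the leaves and ε_j normal to them. In an orthonormal frame the Koszul formula has no derivative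
terms, so every connection coefficient is a combination of the structure functions g([X, Y], Z) of
frame fields (`two_mul_connCoeff`). Lie brackets do not involve the metric, which makes the effect
of the change of metric easy to trace.

Write A_aij = g([e_a, ε_i], ε_j), α_ajb = g([e_a, ε_j], e_b), τ_ija = g([ε_i, ε_j], e_a).
Involutivity gives g([e_a, e_b], ε_j) = 0. Minimality of the leaves says ∑_a α_aja = 0 for every j
on a neighbourhood, so the terms with H and its derivatives drop out. Expanding the sectional
curvatures and summing, with all antisymmetric remainders cancelling, gives
(`IsAdaptedFrameAt.mixedScalarCurvature_eq`) S_mix = div^⊤ H^⊥ - ‖h‖² - ‖h^⊥‖² + ‖T‖², where div^⊤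
is the leafwise divergence, g(H^⊥, e_a) = ∑_j A_ajj, h has coefficients (α_ajb + α_bja)/2 up to
sign, h^⊥ has coefficients (A_aij + A_aji)/2, and T has coefficients τ_ija/2.

For the new metric, e_a and u⁻¹ ε_j form an adapted frame. Its structure functions are u⁻¹ α, u⁻² τ
and A_aij - δ_ij e_a(u)/u; those of the e_a alone do not change. So the leaves remain minimal, ‖h‖²
is multiplied by u⁻², ‖T‖² by u⁻⁴, div^⊤ H^⊥ decreases by n Δ^⊤ log u, and ‖h^⊥‖² changes by -2
H^⊥(u)/u + n |∇^⊤u|²/u². The squared gradient from Δ^⊤ log u cancels the one from ‖h^⊥‖², and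
multiplication by u yields the formula (`IsAdaptedFrameAt.mixedScalarCurvature_normalConformal`). If
u is constant on the leaves, all its tangential derivatives vanish.

The remaining work is to connect this with the definitions, which use bases chosen point by point,
local extensions and `Classical.epsilon`. Traces are shown to be independent of the basis
(`IsOrthonormalBasisOf.trace_eq`), Koszul's expression and the curvature are shown to be tensorial,
and adapted frames are built from foliated charts and Gram–Schmidt. -/

/-- `b` is a `g`-orthonormal basis of the subspace `W` of `T_x M`. -/
structure IsOrthonormalBasisOf {E : Type*} [NormedAddCommGroup E] [NormedSpace ℝ E]
    {M : Type*} [TopologicalSpace M] [ChartedSpace E M] (g : TangentMetric E M) (x : M)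
    (W : Submodule ℝ (TangentSpace 𝓘(ℝ, E) x)) {ι : Type*} [Fintype ι] [DecidableEq ι]
    (b : ι → TangentSpace 𝓘(ℝ, E) x) : Prop where
  mem : ∀ i, b i ∈ W
  inner_eq : ∀ i j, g.inner x (b i) (b j) = if i = j then 1 else 0
  sum_eq : ∀ v ∈ W, ∑ i, g.inner x (b i) v • b i = v

/-! ### Orthonormal bases and traces at a point -/

section OrthonormalBasis

variable {E : Type*} [NormedAddCommGroup E] [NormedSpace ℝ E]
  {M : Type*} [TopologicalSpace M] [ChartedSpace E M] {g : TangentMetric E M} {x : M}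
  {W : Submodule ℝ (TangentSpace 𝓘(ℝ, E) x)}
  {ι : Type*} [Fintype ι] [DecidableEq ι] {κ : Type*} [Fintype κ] [DecidableEq κ]

theorem inner_sum_smul_of_orthonormal {b : ι → TangentSpace 𝓘(ℝ, E) x}
    (hb : ∀ i j, g.inner x (b i) (b j) = if i = j then 1 else 0) (c : ι → ℝ) (i : ι) :
    g.inner x (b i) (∑ j, c j • b j) = c i := by
  simp [map_sum, hb]

theorem IsOrthonormalBasisOf.of_card [FiniteDimensional ℝ E] {b : ι → TangentSpace 𝓘(ℝ, E) x}
    (hmem : ∀ i, b i ∈ W) (hb : ∀ i j, g.inner x (b i) (b j) = if i = j then 1 else 0)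
    (hcard : Fintype.card ι = Module.finrank ℝ W) : IsOrthonormalBasisOf g x W b := by
  have : FiniteDimensional ℝ (TangentSpace 𝓘(ℝ, E) x) := inferInstanceAs (FiniteDimensional ℝ E)
  refine ⟨hmem, hb, fun v hv => ?_⟩
  have hli : LinearIndependent ℝ (fun i => (⟨b i, hmem i⟩ : W)) := by
    rw [Fintype.linearIndependent_iff]
    intro c hc i
    have h : ∑ j, c j • b j = 0 := by
      simpa using congrArg (Subtype.val) hc
    rw [← inner_sum_smul_of_orthonormal hb c i, h, map_zero]
  have hspan := hli.span_eq_top_of_card_eq_finrank' hcard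
  have hv' : (⟨v, hv⟩ : W) ∈ Submodule.span ℝ (Set.range fun i => (⟨b i, hmem i⟩ : W)) := by
    rw [hspan]; trivial
  obtain ⟨c, hc⟩ := (Submodule.mem_span_range_iff_exists_fun ℝ).1 hv'
  have h : ∑ j, c j • b j = v := by simpa using congrArg (Subtype.val) hc
  rw [← h]
  simp only [inner_sum_smul_of_orthonormal hb]

theorem tangentBasis_isOrthonormalBasisOf [FiniteDimensional ℝ E] (g : TangentMetric E M) (x : M)
    (W : Submodule ℝ (TangentSpace 𝓘(ℝ, E) x)) :
    IsOrthonormalBasisOf g x W (tangentBasis g x W) :=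
  .of_card (fun i => ((exists_tangentBasis g x W).choose i).2)
    (exists_tangentBasis g x W).choose_spec (by simp)

theorem IsOrthonormalBasisOf.inner_eq_sum {b : ι → TangentSpace 𝓘(ℝ, E) x}
    (hb : IsOrthonormalBasisOf g x W b) {v : TangentSpace 𝓘(ℝ, E) x} (hv : v ∈ W)
    (w : TangentSpace 𝓘(ℝ, E) x) :
    g.inner x v w = ∑ i, g.inner x (b i) v * g.inner x (b i) w := by
  conv_lhs => rw [← hb.sum_eq v hv]
  simp [map_sum, sum_apply]

/-- The trace of a bilinear map over a subspace does not depend on the orthonormal basis. -/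
theorem IsOrthonormalBasisOf.trace_eq {A : Type*} [AddCommGroup A] [Module ℝ A]
    {b : ι → TangentSpace 𝓘(ℝ, E) x} {b' : κ → TangentSpace 𝓘(ℝ, E) x}
    (hb : IsOrthonormalBasisOf g x W b) (hb' : IsOrthonormalBasisOf g x W b')
    (B : TangentSpace 𝓘(ℝ, E) x →ₗ[ℝ] TangentSpace 𝓘(ℝ, E) x →ₗ[ℝ] A) :
    ∑ i, B (b i) (b i) = ∑ i, B (b' i) (b' i) := by
  have h1 : ∀ i, B (b' i) (b' i) = ∑ k, ∑ l,
      (g.inner x (b' i) (b k) * g.inner x (b' i) (b l)) • B (b k) (b l) := by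
    intro i
    conv_lhs => rw [← hb.sum_eq _ (hb'.mem i)]
    simp only [map_sum, map_smul, LinearMap.sum_apply, LinearMap.smul_apply, Finset.smul_sum,
      smul_smul]
    rw [Finset.sum_comm]
    refine Finset.sum_congr rfl fun k _ => Finset.sum_congr rfl fun l _ => ?_
    rw [g.symm x (b k), g.symm x (b l), mul_comm]
  simp only [h1]
  rw [Finset.sum_comm]
  refine Finset.sum_congr rfl fun k _ => ?_
  rw [Finset.sum_comm]
  -- Parseval in the basis `b'` turns the matrix of coefficients into the Gram matrix of `b`, which
  -- is the identity.
  have h2 : ∀ l, ∑ i, (g.inner x (b' i) (b k) * g.inner x (b' i) (b l)) • B (b k) (b l)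
      = (if k = l then (1 : ℝ) else 0) • B (b k) (b l) := by
    intro l
    rw [← Finset.sum_smul, ← hb'.inner_eq_sum (hb.mem k), hb.inner_eq]
  simp [h2]

theorem eq_of_inner_eq {v w : TangentSpace 𝓘(ℝ, E) x}
    (h : ∀ z, g.inner x v z = g.inner x w z) : v = w := by
  by_contra hne
  have h1 := g.pos x (v - w) (sub_ne_zero.2 hne)
  have h2 : g.inner x (v - w) = 0 := by
    ext z
    simp [h]
  simp [h2] at h1

end OrthonormalBasis

/-! ### The orthogonal splitting into tangent and normal spaces -/

namespace Foliation

variable {p n : ℕ} {E : Type*} [NormedAddCommGroup E] [NormedSpace ℝ E]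
  {M : Type*} [TopologicalSpace M] [ChartedSpace E M]
  {F : Foliation p n E M} {g : TangentMetric E M} {x : M}
  {ι : Type*} [Fintype ι] [DecidableEq ι] {κ : Type*} [Fintype κ] [DecidableEq κ]

theorem mem_normal_iff {w : TangentSpace 𝓘(ℝ, E) x} :
    w ∈ F.normal g x ↔ ∀ v ∈ F.tangent x, g.inner x v w = 0 := Iff.rfl

theorem inner_normal_tangent {v w : TangentSpace 𝓘(ℝ, E) x} (hw : w ∈ F.normal g x)
    (hv : v ∈ F.tangent x) : g.inner x w v = 0 := by
  rw [g.symm]; exact hw v hv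

variable [FiniteDimensional ℝ E]

/-- A trace of a bilinear map, hence independent of the basis. This allows the basis chosen point by
point in the definition to be replaced by a smooth frame. -/
theorem tangentPart_eq_sum {b : ι → TangentSpace 𝓘(ℝ, E) x}
    (hb : IsOrthonormalBasisOf g x (F.tangent x) b) (v : TangentSpace 𝓘(ℝ, E) x) :
    F.tangentPart g x v = ∑ i, g.inner x (b i) v • b i := by
  have h := (tangentBasis_isOrthonormalBasisOf g x (F.tangent x)).trace_eq hb
    (LinearMap.mk₂ ℝ (fun v' w' => g.inner x v' v • w') (by simp [add_smul]) (by simp [mul_smul])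
      (by simp) (fun c v w => smul_comm _ _ _))
  simpa [tangentPart, sum_apply] using h

theorem leafGradient_eq_sum {b : ι → TangentSpace 𝓘(ℝ, E) x}
    (hb : IsOrthonormalBasisOf g x (F.tangent x) b) (u : M → ℝ) :
    F.leafGradient g u x = ∑ i, mvfderiv 𝓘(ℝ, E) u x (b i) • b i := by
  have h := (tangentBasis_isOrthonormalBasisOf g x (F.tangent x)).trace_eq hb
    (LinearMap.mk₂ ℝ (fun v' w' => mvfderiv 𝓘(ℝ, E) u x v' • w') (by simp [add_smul])
      (by simp [mul_smul]) (by simp) (fun c v w => smul_comm _ _ _))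
  simpa [leafGradient] using h

theorem tangentPart_mem (v : TangentSpace 𝓘(ℝ, E) x) : F.tangentPart g x v ∈ F.tangent x := by
  have hb := tangentBasis_isOrthonormalBasisOf g x (F.tangent x)
  rw [tangentPart_eq_sum hb]
  exact Submodule.sum_mem _ fun i _ => Submodule.smul_mem _ _ (hb.mem i)

theorem tangentPart_of_mem {v : TangentSpace 𝓘(ℝ, E) x} (hv : v ∈ F.tangent x) :
    F.tangentPart g x v = v := by
  have hb := tangentBasis_isOrthonormalBasisOf g x (F.tangent x)
  rw [tangentPart_eq_sum hb, hb.sum_eq v hv]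

theorem inner_tangentPart {v : TangentSpace 𝓘(ℝ, E) x} (hv : v ∈ F.tangent x)
    (w : TangentSpace 𝓘(ℝ, E) x) : g.inner x v (F.tangentPart g x w) = g.inner x v w := by
  have hb := tangentBasis_isOrthonormalBasisOf g x (F.tangent x)
  rw [tangentPart_eq_sum hb, hb.inner_eq_sum hv w, map_sum]
  refine Finset.sum_congr rfl fun i _ => ?_
  rw [map_smul, smul_eq_mul, mul_comm, g.symm x v]

theorem normalPart_mem (v : TangentSpace 𝓘(ℝ, E) x) : F.normalPart g x v ∈ F.normal g x := by
  intro w hw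
  simp [normalPart, inner_tangentPart hw]

theorem tangentPart_add_normalPart (v : TangentSpace 𝓘(ℝ, E) x) :
    F.tangentPart g x v + F.normalPart g x v = v := by
  simp [normalPart]

theorem tangentPart_of_mem_normal {w : TangentSpace 𝓘(ℝ, E) x} (hw : w ∈ F.normal g x) :
    F.tangentPart g x w = 0 := by
  have hb := tangentBasis_isOrthonormalBasisOf g x (F.tangent x)
  rw [tangentPart_eq_sum hb]
  exact Finset.sum_eq_zero fun i _ => by rw [hw _ (hb.mem i), zero_smul]

theorem normalPart_of_mem {v : TangentSpace 𝓘(ℝ, E) x} (hv : v ∈ F.tangent x) :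
    F.normalPart g x v = 0 := by
  simp [normalPart, tangentPart_of_mem hv]

theorem normalPart_of_mem_normal {w : TangentSpace 𝓘(ℝ, E) x} (hw : w ∈ F.normal g x) :
    F.normalPart g x w = w := by
  simp [normalPart, tangentPart_of_mem_normal hw]

theorem inner_normalPart {v : TangentSpace 𝓘(ℝ, E) x} (hv : v ∈ F.normal g x)
    (w : TangentSpace 𝓘(ℝ, E) x) : g.inner x v (F.normalPart g x w) = g.inner x v w := by
  have h : F.normalPart g x w = w - F.tangentPart g x w := by simp [normalPart]
  rw [h, map_sub, inner_normal_tangent hv (tangentPart_mem w), sub_zero]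

theorem isCompl_tangent_normal : IsCompl (F.tangent x) (F.normal g x) := by
  constructor
  · rw [Submodule.disjoint_def]
    intro v hv hv'
    by_contra hne
    exact (g.pos x v hne).ne' (hv' v hv)
  · rw [codisjoint_iff, eq_top_iff]
    intro v _
    rw [← tangentPart_add_normalPart (F := F) (g := g) v]
    exact Submodule.add_mem_sup (tangentPart_mem v) (normalPart_mem v)

theorem finrank_tangent_add_finrank_normal :
    Module.finrank ℝ (F.tangent x) + Module.finrank ℝ (F.normal g x) = Module.finrank ℝ E := by
  have : FiniteDimensional ℝ (TangentSpace 𝓘(ℝ, E) x) := inferInstanceAs (FiniteDimensional ℝ E)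
  exact Submodule.finrank_add_eq_of_isCompl (isCompl_tangent_normal (F := F) (g := g) (x := x))

/-- Orthonormal bases of the tangent and of the normal space form an orthonormal basis of
`T_x M`. -/
theorem isOrthonormalBasisOf_sumElim {b : ι → TangentSpace 𝓘(ℝ, E) x}
    {c : κ → TangentSpace 𝓘(ℝ, E) x} (hb : IsOrthonormalBasisOf g x (F.tangent x) b)
    (hc : IsOrthonormalBasisOf g x (F.normal g x) c) :
    IsOrthonormalBasisOf g x ⊤ (Sum.elim b c) where
  mem _ := trivial
  inner_eq i j := by
    rcases i with i | i <;> rcases j with j | j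
    · simp [hb.inner_eq]
    · simp [hc.mem j _ (hb.mem i)]
    · simp [inner_normal_tangent (hc.mem i) (hb.mem j)]
    · simp [hc.inner_eq]
  sum_eq v _ := by
    rw [Fintype.sum_sum_type]
    simp only [Sum.elim_inl, Sum.elim_inr]
    rw [← tangentPart_eq_sum hb]
    conv_rhs => rw [← tangentPart_add_normalPart (F := F) (g := g) v]
    congr 1
    rw [← hc.sum_eq _ (normalPart_mem v)]
    exact Finset.sum_congr rfl fun i _ => by rw [inner_normalPart (hc.mem i)]

/-! ### The rescaled metric at a point -/

section NormalConformal

variable {u : M → ℝ} {hu : ∀ x, 0 < u x}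

theorem normalConformal_inner (v w : TangentSpace 𝓘(ℝ, E) x) :
    (F.normalConformal g u hu).inner x v w
      = g.inner x (F.tangentPart g x v) (F.tangentPart g x w)
        + u x ^ 2 * g.inner x (F.normalPart g x v) (F.normalPart g x w) := rfl

theorem normalConformal_inner_tangent {v : TangentSpace 𝓘(ℝ, E) x} (hv : v ∈ F.tangent x)
    (w : TangentSpace 𝓘(ℝ, E) x) :
    (F.normalConformal g u hu).inner x v w = g.inner x v w := by
  simp [normalConformal_inner, tangentPart_of_mem hv, normalPart_of_mem hv, inner_tangentPart hv]

theorem normalConformal_inner_normal {v : TangentSpace 𝓘(ℝ, E) x} (hv : v ∈ F.normal g x)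
    (w : TangentSpace 𝓘(ℝ, E) x) :
    (F.normalConformal g u hu).inner x v w = u x ^ 2 * g.inner x v w := by
  simp [normalConformal_inner, tangentPart_of_mem_normal hv, normalPart_of_mem_normal hv,
    inner_normalPart hv]

theorem normal_normalConformal :
    F.normal (F.normalConformal g u hu) x = F.normal g x := by
  ext w
  rw [mem_normal_iff, mem_normal_iff]
  exact forall₂_congr fun v hv => by rw [normalConformal_inner_tangent hv]

theorem isOrthonormalBasisOf_tangent_normalConformal {b : ι → TangentSpace 𝓘(ℝ, E) x}
    (hb : IsOrthonormalBasisOf g x (F.tangent x) b) :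
    IsOrthonormalBasisOf (F.normalConformal g u hu) x (F.tangent x) b where
  mem := hb.mem
  inner_eq i j := by rw [normalConformal_inner_tangent (hb.mem i), hb.inner_eq]
  sum_eq v hv := by
    simp only [normalConformal_inner_tangent (hb.mem _)]
    exact hb.sum_eq v hv

theorem isOrthonormalBasisOf_normal_normalConformal {b : ι → TangentSpace 𝓘(ℝ, E) x}
    (hb : IsOrthonormalBasisOf g x (F.normal g x) b) :
    IsOrthonormalBasisOf (F.normalConformal g u hu) x (F.normal (F.normalConformal g u hu) x)
      (fun i => (u x)⁻¹ • b i) where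
  mem i := by
    rw [normal_normalConformal]
    exact Submodule.smul_mem _ _ (hb.mem i)
  inner_eq i j := by
    have := (hu x).ne'
    rw [normalConformal_inner_normal (Submodule.smul_mem _ _ (hb.mem i))]
    simp only [map_smul, smul_apply, hb.inner_eq, smul_eq_mul]
    split_ifs <;> field_simp
  sum_eq v hv := by
    have := (hu x).ne'
    rw [normal_normalConformal] at hv
    conv_rhs => rw [← hb.sum_eq v hv]
    refine Finset.sum_congr rfl fun i _ => ?_
    rw [normalConformal_inner_normal (Submodule.smul_mem _ _ (hb.mem i)), smul_smul]
    simp only [map_smul, smul_apply, smul_eq_mul]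
    congr 1
    field_simp

end NormalConformal

end Foliation

/-! ### Smooth fields, Koszul's formula and the Levi-Civita connection -/

section LeviCivita

variable {E : Type*} [NormedAddCommGroup E] [NormedSpace ℝ E]
  {M : Type*} [TopologicalSpace M] [ChartedSpace E M] [IsManifold 𝓘(ℝ, E) ∞ M]

/-- `X` is a vector field that is differentiable at `x`. -/
abbrev DiffFieldAt (X : ∀ x : M, TangentSpace 𝓘(ℝ, E) x) (x : M) : Prop :=
  MDifferentiableAt 𝓘(ℝ, E) 𝓘(ℝ, E).tangent (fun y => (⟨y, X y⟩ : TangentBundle 𝓘(ℝ, E) M)) x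

/-- The field of inner products `g` is smooth: inner products of smooth (differentiable) fields are
smooth (differentiable). -/
structure IsSmoothMetric (g : TangentMetric E M) : Prop where
  mdifferentiableAt : ∀ {X Y : ∀ x : M, TangentSpace 𝓘(ℝ, E) x} {x : M}, DiffFieldAt X x →
    DiffFieldAt Y x → MDifferentiableAt 𝓘(ℝ, E) 𝓘(ℝ, ℝ) (fun y => g.inner y (X y) (Y y)) x
  contMDiffAt : ∀ {X Y : ∀ x : M, TangentSpace 𝓘(ℝ, E) x} {x : M}, SmoothFieldAt X x →
    SmoothFieldAt Y x → ContMDiffAt 𝓘(ℝ, E) 𝓘(ℝ, ℝ) ∞ (fun y => g.inner y (X y) (Y y)) x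

theorem isSmoothMetric_toRiemannianMetric
    (g : ContMDiffRiemannianMetric 𝓘(ℝ, E) ∞ E (fun x : M => TangentSpace 𝓘(ℝ, E) x)) :
    IsSmoothMetric g.toRiemannianMetric := by
  refine ⟨fun {X Y x} hX hY => ?_, fun {X Y x} hX hY => ?_⟩
  · have h := MDifferentiableAt.clm_bundle_apply₂ (F₁ := E) (F₂ := E) (F₃ := ℝ)
      (E₃ := Bundle.Trivial M ℝ) (b := id) (g.contMDiff.contMDiffAt.mdifferentiableAt (by simp))
      hX hY
    simp only [mdifferentiableAt_totalSpace] at h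
    exact h.2
  · have h := ContMDiffAt.clm_bundle_apply₂ (F₁ := E) (F₂ := E) (F₃ := ℝ)
      (E₃ := Bundle.Trivial M ℝ) (b := id) g.contMDiff.contMDiffAt hX hY
    simp only [contMDiffAt_totalSpace] at h
    exact h.2

variable {g : TangentMetric E M} {x : M} {X Y Z W : ∀ x : M, TangentSpace 𝓘(ℝ, E) x}

theorem SmoothFieldAt.diffFieldAt (h : SmoothFieldAt X x) : DiffFieldAt X x :=
  ContMDiffAt.mdifferentiableAt h (by simp)

theorem SmoothFieldAt.eventually_diffFieldAt (h : SmoothFieldAt X x) :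
    ∀ᶠ y in 𝓝 x, DiffFieldAt X y := by
  have h1 : ContMDiffAt 𝓘(ℝ, E) 𝓘(ℝ, E).tangent 1
    (fun y => (⟨y, X y⟩ : TangentBundle 𝓘(ℝ, E) M)) x := ContMDiffAt.of_le h (by simp)
  filter_upwards [(contMDiffAt_iff_contMDiffAt_nhds (by simp)).1 h1] with y hy
  exact hy.mdifferentiableAt one_ne_zero

theorem ContMDiffAt.eventually_mdifferentiableAt {f : M → ℝ}
    (h : ContMDiffAt 𝓘(ℝ, E) 𝓘(ℝ, ℝ) ∞ f x) :
    ∀ᶠ y in 𝓝 x, MDifferentiableAt 𝓘(ℝ, E) 𝓘(ℝ, ℝ) f y := by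
  have h1 : ContMDiffAt 𝓘(ℝ, E) 𝓘(ℝ, ℝ) 1 f x := ContMDiffAt.of_le h (by simp)
  filter_upwards [(contMDiffAt_iff_contMDiffAt_nhds (by simp)).1 h1] with y hy
  exact hy.mdifferentiableAt one_ne_zero



theorem smoothFieldAt_extend [FiniteDimensional ℝ E] (v : TangentSpace 𝓘(ℝ, E) x) :
    SmoothFieldAt (FiberBundle.extend E v) x :=
  FiberBundle.contMDiffAt_extend 𝓘(ℝ, E) E v

theorem SmoothFieldAt.smul {f : M → ℝ} (hf : ContMDiffAt 𝓘(ℝ, E) 𝓘(ℝ, ℝ) ∞ f x)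
    (hX : SmoothFieldAt X x) : SmoothFieldAt (fun y => f y • X y) x :=
  ContMDiffAt.smul_section hf hX

theorem SmoothFieldAt.sum {ι : Type*} {s : Finset ι} {X : ι → ∀ x : M, TangentSpace 𝓘(ℝ, E) x}
    (hX : ∀ i, SmoothFieldAt (X i) x) : SmoothFieldAt (fun y => ∑ i ∈ s, X i y) x :=
  ContMDiffAt.sum_section (fun i _ => hX i)

theorem SmoothFieldAt.sub (hX : SmoothFieldAt X x) (hY : SmoothFieldAt Y x) :
    SmoothFieldAt (fun y => X y - Y y) x :=
  ContMDiffAt.sub_section hX hY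

theorem SmoothFieldAt.congr (hX : SmoothFieldAt X x) (h : Y =ᶠ[𝓝 x] X) : SmoothFieldAt Y x :=
  ContMDiffAt.congr_of_eventuallyEq hX (h.mono fun y hy => by simp [hy])

theorem DiffFieldAt.congr (hX : DiffFieldAt X x) (h : Y =ᶠ[𝓝 x] X) : DiffFieldAt Y x :=
  MDifferentiableAt.congr_of_eventuallyEq hX (h.mono fun y hy => by simp [hy])

theorem DiffFieldAt.smul {f : M → ℝ} (hf : MDifferentiableAt 𝓘(ℝ, E) 𝓘(ℝ, ℝ) f x)
    (hX : DiffFieldAt X x) : DiffFieldAt (fun y => f y • X y) x :=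
  MDifferentiableAt.smul_section hf hX

theorem DiffFieldAt.sub (hX : DiffFieldAt X x) (hY : DiffFieldAt Y x) :
    DiffFieldAt (fun y => X y - Y y) x :=
  mdifferentiableAt_sub_section hX hY

theorem DiffFieldAt.add (hX : DiffFieldAt X x) (hY : DiffFieldAt Y x) :
    DiffFieldAt (fun y => X y + Y y) x :=
  mdifferentiableAt_add_section hX hY

theorem DiffFieldAt.sum {ι : Type*} {s : Finset ι} {X : ι → ∀ x : M, TangentSpace 𝓘(ℝ, E) x}
    (hX : ∀ i, DiffFieldAt (X i) x) : DiffFieldAt (fun y => ∑ i ∈ s, X i y) x :=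
  MDifferentiableAt.sum_section (fun i _ => hX i)

theorem SmoothFieldAt.mlieBracket [FiniteDimensional ℝ E]
    (hX : SmoothFieldAt X x) (hY : SmoothFieldAt Y x) :
    SmoothFieldAt (mlieBracket 𝓘(ℝ, E) X Y) x := by
  have : IsManifold 𝓘(ℝ, E) (((⊤ : ℕ∞) : WithTop ℕ∞) + 1) M := by simpa
  have : IsManifold 𝓘(ℝ, E) (minSmoothness ℝ 2) M := by
    rw [minSmoothness_of_isRCLikeNormedField]; infer_instance
  have := FiniteDimensional.complete ℝ E
  exact ContMDiffAt.mlieBracket_vectorField (m := ⊤) (n := ⊤) hX hY (by simp)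

theorem ContMDiffAt.mvfderiv_apply {f : M → ℝ} (hf : ContMDiffAt 𝓘(ℝ, E) 𝓘(ℝ, ℝ) ∞ f x)
    (hX : SmoothFieldAt X x) :
    ContMDiffAt 𝓘(ℝ, E) 𝓘(ℝ, ℝ) ∞ (fun y => mvfderiv 𝓘(ℝ, E) f y (X y)) x := by
  have h1 := ContMDiffAt.mfderiv_const (m := ∞) hf (by simp)
  have h2 := ContMDiffAt.clm_apply_of_inCoordinates (b₁ := id) (b₂ := f) (v := X)
    (E₁ := fun y : M => TangentSpace 𝓘(ℝ, E) y) (E₂ := fun t : ℝ => TangentSpace 𝓘(ℝ, ℝ) t)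
    h1 hX hf
  exact (contMDiff_snd_tangentBundle_modelSpace ℝ 𝓘(ℝ, ℝ)).contMDiffAt.comp x h2

/-- Replacing X by f X creates derivatives of f in two of the differentiated inner products and in
the brackets [X, Y] and [X, Z]; these cancel in pairs. -/
theorem tensorialAt_koszul_left [FiniteDimensional ℝ E] (hg : IsSmoothMetric g)
    (hY : DiffFieldAt Y x) (hZ : DiffFieldAt Z x) :
    TensorialAt 𝓘(ℝ, E) E (fun X : ∀ x : M, TangentSpace 𝓘(ℝ, E) x => koszul g X Y Z x) x := by
  have := FiniteDimensional.complete ℝ E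
  constructor
  · intro f X hf hX
    have h1 : (fun y => g.inner y (Z y) ((f • X) y)) = fun y => f y * g.inner y (Z y) (X y) := by
      ext y; simp
    have h2 : (fun y => g.inner y ((f • X) y) (Y y)) = fun y => f y * g.inner y (X y) (Y y) := by
      ext y; simp
    simp only [koszul, h1, h2, mvfderiv_fun_mul hf (hg.mdifferentiableAt hZ hX),
      mvfderiv_fun_mul hf (hg.mdifferentiableAt hX hY), mlieBracket_smul_left hf hX]
    simp only [Pi.smul_apply', map_smul, map_add, map_neg, smul_apply, add_apply, neg_apply, neg_smul,
      smul_eq_mul, g.symm x (Z x) (X x)]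
    rw [g.symm x (X x) (Y x), g.symm x (X x) (Z x)]
    ring
  · intro X X' hX hX'
    have h1 : (fun y => g.inner y (Z y) ((X + X') y))
        = fun y => g.inner y (Z y) (X y) + g.inner y (Z y) (X' y) := by
      ext y; simp
    have h2 : (fun y => g.inner y ((X + X') y) (Y y))
        = fun y => g.inner y (X y) (Y y) + g.inner y (X' y) (Y y) := by
      ext y; simp
    simp only [koszul, h1, h2,
      mvfderiv_fun_add (hg.mdifferentiableAt hZ hX) (hg.mdifferentiableAt hZ hX'),
      mvfderiv_fun_add (hg.mdifferentiableAt hX hY) (hg.mdifferentiableAt hX' hY),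
      mlieBracket_add_left hX hX']
    simp only [Pi.add_apply, map_add, add_apply]
    ring

theorem tensorialAt_koszul_right [FiniteDimensional ℝ E] (hg : IsSmoothMetric g)
    (hX : DiffFieldAt X x) (hY : DiffFieldAt Y x) :
    TensorialAt 𝓘(ℝ, E) E (fun Z : ∀ x : M, TangentSpace 𝓘(ℝ, E) x => koszul g X Y Z x) x := by
  have := FiniteDimensional.complete ℝ E
  constructor
  · intro f Z hf hZ
    have h1 : (fun y => g.inner y ((f • Z) y) (X y)) = fun y => f y * g.inner y (Z y) (X y) := by
      ext y; simp
    have h2 : (fun y => g.inner y (Y y) ((f • Z) y)) = fun y => f y * g.inner y (Y y) (Z y) := by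
      ext y; simp
    simp only [koszul, h1, h2, mvfderiv_fun_mul hf (hg.mdifferentiableAt hZ hX),
      mvfderiv_fun_mul hf (hg.mdifferentiableAt hY hZ), mlieBracket_smul_right hf hZ]
    simp only [Pi.smul_apply', map_smul, map_add, smul_apply, add_apply, smul_eq_mul]
    rw [g.symm x (Y x) (Z x)]
    ring
  · intro Z Z' hZ hZ'
    have h1 : (fun y => g.inner y ((Z + Z') y) (X y))
        = fun y => g.inner y (Z y) (X y) + g.inner y (Z' y) (X y) := by
      ext y; simp
    have h2 : (fun y => g.inner y (Y y) ((Z + Z') y))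
        = fun y => g.inner y (Y y) (Z y) + g.inner y (Y y) (Z' y) := by
      ext y; simp
    simp only [koszul, h1, h2,
      mvfderiv_fun_add (hg.mdifferentiableAt hZ hX) (hg.mdifferentiableAt hZ' hX),
      mvfderiv_fun_add (hg.mdifferentiableAt hY hZ) (hg.mdifferentiableAt hY hZ'),
      mlieBracket_add_right hZ hZ']
    simp only [Pi.add_apply, map_add, add_apply]
    ring

variable [FiniteDimensional ℝ E]

/-- Koszul's formula. -/
theorem two_mul_inner_leviCivita (hg : IsSmoothMetric g) (hX : DiffFieldAt X x)
    (hY : DiffFieldAt Y x) (hZ : DiffFieldAt Z x) :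
    2 * g.inner x (leviCivita g x (X x) Y) (Z x) = koszul g X Y Z x := by
  -- Tensoriality in X and Z: only their values at `x` matter, so merely differentiable fields may
  -- stand for the smooth ones in the definition of `leviCivita`.
  have hT : ∀ {X X' Z Z' : ∀ x : M, TangentSpace 𝓘(ℝ, E) x}, DiffFieldAt X x → DiffFieldAt X' x →
      DiffFieldAt Z x → DiffFieldAt Z' x → X x = X' x → Z x = Z' x →
      koszul g X Y Z x = koszul g X' Y Z' x := fun hX hX' hZ hZ' h1 h2 =>
    TensorialAt.pointwise₂ (Φ := fun X Z => koszul g X Y Z x)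
      (fun Z hZ => tensorialAt_koszul_left hg hY hZ)
      (fun X hX => tensorialAt_koszul_right hg hX hY) hX hX' hZ hZ' h1 h2
  set K := TensorialAt.mkHom (fun Z => koszul g X Y Z x) x (tensorialAt_koszul_right hg hX hY)
  have hb := tangentBasis_isOrthonormalBasisOf g x ⊤
  -- The property that defines `leviCivita` is satisfiable, so `Classical.epsilon` really satisfies
  -- it; the witness represents the functional `K / 2` by its coordinates in an orthonormal basis.
  have hex : ∃ w : TangentSpace 𝓘(ℝ, E) x, ∀ X' Z' : ∀ x : M, TangentSpace 𝓘(ℝ, E) x,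
      SmoothFieldAt X' x → SmoothFieldAt Z' x → X' x = X x →
      2 * g.inner x w (Z' x) = koszul g X' Y Z' x := by
    refine ⟨∑ i, (K (tangentBasis g x ⊤ i) / 2) • tangentBasis g x ⊤ i,
      fun X' Z' hX' hZ' h => ?_⟩
    rw [hT hX'.diffFieldAt hX hZ'.diffFieldAt hZ'.diffFieldAt h rfl]
    have h1 : koszul g X Y Z' x = K (Z' x) :=
      (TensorialAt.mkHom_apply (tensorialAt_koszul_right hg hX hY) hZ'.diffFieldAt).symm
    rw [h1]
    conv_rhs => rw [← hb.sum_eq (Z' x) trivial]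
    simp only [map_sum, map_smul, smul_apply, sum_apply, Finset.mul_sum, smul_eq_mul]
    exact Finset.sum_congr rfl fun i _ => by ring
  have h := Classical.epsilon_spec hex (FiberBundle.extend E (X x)) (FiberBundle.extend E (Z x))
    (smoothFieldAt_extend _) (smoothFieldAt_extend _) (by simp)
  rw [FiberBundle.extend_apply_self] at h
  rw [leviCivita, h]
  exact hT (smoothFieldAt_extend _).diffFieldAt hX (smoothFieldAt_extend _).diffFieldAt hZ
    (by simp) (by simp)

end LeviCivita

section LeviCivita

variable {E : Type*} [NormedAddCommGroup E] [NormedSpace ℝ E]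
  {M : Type*} [TopologicalSpace M] [ChartedSpace E M]
  {g : TangentMetric E M} {x : M} {X Y Z W : ∀ x : M, TangentSpace 𝓘(ℝ, E) x}

theorem mvfderiv_congr_of_eventuallyEq {f f' : M → ℝ} (h : f =ᶠ[𝓝 x] f') :
    mvfderiv 𝓘(ℝ, E) f x = mvfderiv 𝓘(ℝ, E) f' x := by
  unfold mvfderiv
  rw [h.mfderiv_eq, h.eq_of_nhds]

variable [IsManifold 𝓘(ℝ, E) ∞ M]

theorem leviCivita_congr {Y Y' : ∀ x : M, TangentSpace 𝓘(ℝ, E) x} (h : Y =ᶠ[𝓝 x] Y')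
    (v : TangentSpace 𝓘(ℝ, E) x) : leviCivita g x v Y = leviCivita g x v Y' := by
  have hk : ∀ X Z : ∀ x : M, TangentSpace 𝓘(ℝ, E) x, koszul g X Y Z x = koszul g X Y' Z x := by
    intro X Z
    have h1 : (fun y => g.inner y (Y y) (Z y)) =ᶠ[𝓝 x] fun y => g.inner y (Y' y) (Z y) :=
      h.mono fun y hy => by simp [hy]
    have h2 : (fun y => g.inner y (X y) (Y y)) =ᶠ[𝓝 x] fun y => g.inner y (X y) (Y' y) :=
      h.mono fun y hy => by simp [hy]
    simp only [koszul, mvfderiv_congr_of_eventuallyEq h1, mvfderiv_congr_of_eventuallyEq h2,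
      h.eq_of_nhds, h.mlieBracket_vectorField_eq (Filter.EventuallyEq.refl _ Z),
      (Filter.EventuallyEq.refl _ X).mlieBracket_vectorField_eq h]
  simp only [leviCivita, hk]

/-! ### Orthonormal frames and the calculus of the connection -/

/-- Gram–Schmidt orthonormalization of a family of vector fields that is orthonormal at `x`. -/
theorem exists_orthonormal_fields (hg : IsSmoothMetric g) {m : ℕ}
    (X : Fin m → ∀ x : M, TangentSpace 𝓘(ℝ, E) x) (hX : ∀ i, SmoothFieldAt (X i) x)
    (ho : ∀ i j, g.inner x (X i x) (X j x) = if i = j then 1 else 0) :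
    ∃ e : Fin m → ∀ x : M, TangentSpace 𝓘(ℝ, E) x, (∀ i, SmoothFieldAt (e i) x) ∧
      (∀ i, e i x = X i x) ∧
      (∀ᶠ y in 𝓝 x, ∀ i j, g.inner y (e i y) (e j y) = if i = j then 1 else 0) ∧
      ∀ y i, e i y ∈ Submodule.span ℝ (Set.range fun i => X i y) := by
  induction m with
  | zero => exact ⟨X, hX, fun _ => rfl, by simp, fun y i => i.elim0⟩
  | succ m ih =>
    obtain ⟨e, he, hex, heo, hes⟩ := ih (fun i => X i.castSucc) (fun i => hX _)
      (fun i j => by simp [ho])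
    set Z : ∀ x : M, TangentSpace 𝓘(ℝ, E) x := fun y => X (Fin.last m) y
      - ∑ i, g.inner y (e i y) (X (Fin.last m) y) • e i y with hZdef
    have hZ : SmoothFieldAt Z x :=
      (hX _).sub (SmoothFieldAt.sum fun i => (he i).smul (hg.contMDiffAt (he i) (hX _)))
    have hZx : Z x = X (Fin.last m) x := by
      simp [hZdef, hex, ho, Fin.castSucc_ne_last]
    set N : M → ℝ := fun y => g.inner y (Z y) (Z y) with hN
    have hNs : ContMDiffAt 𝓘(ℝ, E) 𝓘(ℝ, ℝ) ∞ N x := hg.contMDiffAt hZ hZ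
    -- The given fields are already orthonormal at `x`, so the Gram–Schmidt correction vanishes
    -- there. Hence the norm is 1 at `x` and positive nearby, where its inverse square root is
    -- smooth.
    have hNx : N x = 1 := by simp [hN, hZx, ho]
    have hf : ContMDiffAt 𝓘(ℝ, E) 𝓘(ℝ, ℝ) ∞ (fun y => (Real.sqrt (N y))⁻¹) x := by
      have h1 : ContDiffAt ℝ ∞ (fun t : ℝ => (Real.sqrt t)⁻¹) (N x) := by
        rw [hNx]
        exact (Real.contDiffAt_sqrt one_ne_zero).inv (by simp)
      exact h1.contMDiffAt.comp x hNs
    have hpos : ∀ᶠ y in 𝓝 x, 0 < N y :=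
      hNs.continuousAt.eventually (lt_mem_nhds (by rw [hNx]; norm_num))
    refine ⟨Fin.snoc e (fun y => (Real.sqrt (N y))⁻¹ • Z y), ?_, ?_, ?_, ?_⟩
    · intro i
      refine Fin.lastCases ?_ (fun i => ?_) i
      · simpa using hZ.smul hf
      · simpa using he i
    · intro i
      refine Fin.lastCases ?_ (fun i => ?_) i
      · simp [hNx, hZx]
      · simpa using hex i
    · filter_upwards [heo, hpos] with y hy hpy
      have hZe : ∀ i, g.inner y (e i y) (Z y) = 0 := by
        intro i
        simp [hZdef, map_sum, hy]
      have hs : Real.sqrt (N y) ≠ 0 := (Real.sqrt_pos.2 hpy).ne'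
      have hNy : g.inner y (Z y) (Z y) = Real.sqrt (N y) * Real.sqrt (N y) :=
        (Real.mul_self_sqrt hpy.le).symm
      intro i j
      refine Fin.lastCases ?_ (fun i => ?_) i <;> refine Fin.lastCases ?_ (fun j => ?_) j
      · simp only [Fin.snoc_last, map_smul, smul_apply, smul_eq_mul, hNy, if_true]
        field_simp
      · have := hZe j
        rw [g.symm] at this
        simp [this, (Fin.castSucc_ne_last j).symm]
      · simp [hZe, Fin.castSucc_ne_last]
      · simp [hy]
    · intro y i
      have hes' : ∀ i, e i y ∈ Submodule.span ℝ (Set.range fun i => X i y) := fun i =>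
        Submodule.span_mono (by rintro _ ⟨j, rfl⟩; exact ⟨j.castSucc, rfl⟩) (hes y i)
      refine Fin.lastCases ?_ (fun i => ?_) i
      · simp only [Fin.snoc_last]
        refine Submodule.smul_mem _ _ (Submodule.sub_mem _ (Submodule.subset_span ⟨_, rfl⟩) ?_)
        exact Submodule.sum_mem _ fun i _ => Submodule.smul_mem _ _ (hes' i)
      · simpa using hes' i

/-- `e` is a smooth local `g`-orthonormal frame around `x`. -/
structure IsOrthonormalFrameAt (g : TangentMetric E M) (x : M) {ι : Type*} [Fintype ι]
    [DecidableEq ι] (e : ι → ∀ x : M, TangentSpace 𝓘(ℝ, E) x) : Prop where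
  smooth : ∀ i, SmoothFieldAt (e i) x
  basis : ∀ᶠ y in 𝓝 x, IsOrthonormalBasisOf g y ⊤ (fun i => e i y)

variable [FiniteDimensional ℝ E]

theorem exists_isOrthonormalFrameAt (hg : IsSmoothMetric g) (x : M) :
    ∃ e : Fin (Module.finrank ℝ E) → ∀ x : M, TangentSpace 𝓘(ℝ, E) x,
      IsOrthonormalFrameAt g x e := by
  have hr : Module.finrank ℝ (⊤ : Submodule ℝ (TangentSpace 𝓘(ℝ, E) x)) = Module.finrank ℝ E :=
    finrank_top ℝ (TangentSpace 𝓘(ℝ, E) x)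
  have hb := tangentBasis_isOrthonormalBasisOf g x ⊤
  obtain ⟨e, he, -, heo, -⟩ := exists_orthonormal_fields hg
    (fun i => FiberBundle.extend E (tangentBasis g x ⊤ (Fin.cast hr.symm i)))
    (fun i => smoothFieldAt_extend _) (by simp [hb.inner_eq])
  refine ⟨e, he, heo.mono fun y hy => .of_card (fun _ => trivial) hy ?_⟩
  rw [Fintype.card_fin]
  exact (finrank_top ℝ (TangentSpace 𝓘(ℝ, E) y)).symm

theorem leviCivita_add_left (hg : IsSmoothMetric g) (hY : DiffFieldAt Y x)
    (v w : TangentSpace 𝓘(ℝ, E) x) :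
    leviCivita g x (v + w) Y = leviCivita g x v Y + leviCivita g x w Y := by
  refine eq_of_inner_eq (g := g) fun z => ?_
  have hv := (smoothFieldAt_extend v).diffFieldAt
  have hw := (smoothFieldAt_extend w).diffFieldAt
  have hz := (smoothFieldAt_extend z).diffFieldAt
  have h := (tensorialAt_koszul_left hg hY hz).add hv hw
  rw [← two_mul_inner_leviCivita hg hv hY hz, ← two_mul_inner_leviCivita hg hw hY hz,
    ← two_mul_inner_leviCivita hg
      (X := FiberBundle.extend E v + FiberBundle.extend E w) (hv.add hw) hY hz] at h
  simp only [Pi.add_apply, FiberBundle.extend_apply_self] at h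
  rw [map_add, add_apply]
  linarith

theorem leviCivita_smul_left (hg : IsSmoothMetric g) (hY : DiffFieldAt Y x) (c : ℝ)
    (v : TangentSpace 𝓘(ℝ, E) x) : leviCivita g x (c • v) Y = c • leviCivita g x v Y := by
  refine eq_of_inner_eq (g := g) fun z => ?_
  have hv := (smoothFieldAt_extend v).diffFieldAt
  have hz := (smoothFieldAt_extend z).diffFieldAt
  have hc : MDifferentiableAt 𝓘(ℝ, E) 𝓘(ℝ, ℝ) (fun _ : M => c) x := mdifferentiableAt_const
  have h := (tensorialAt_koszul_left hg hY hz).smul hc hv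
  rw [← two_mul_inner_leviCivita hg hv hY hz,
    ← two_mul_inner_leviCivita hg (X := (fun _ => c) • FiberBundle.extend E v) (hv.smul hc) hY hz]
    at h
  simp only [Pi.smul_apply', FiberBundle.extend_apply_self, smul_eq_mul] at h
  rw [map_smul, smul_apply, smul_eq_mul]
  linarith

/-- The covariant derivative of `Y` at `x` as a linear map. -/
noncomputable def leviCivitaHom (hg : IsSmoothMetric g) (hY : DiffFieldAt Y x) :
    TangentSpace 𝓘(ℝ, E) x →ₗ[ℝ] TangentSpace 𝓘(ℝ, E) x where
  toFun v := leviCivita g x v Y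
  map_add' := leviCivita_add_left hg hY
  map_smul' := leviCivita_smul_left hg hY

theorem leviCivita_sum_left (hg : IsSmoothMetric g) (hY : DiffFieldAt Y x) {ι : Type*}
    (s : Finset ι) (c : ι → ℝ) (v : ι → TangentSpace 𝓘(ℝ, E) x) :
    leviCivita g x (∑ i ∈ s, c i • v i) Y = ∑ i ∈ s, c i • leviCivita g x (v i) Y := by
  change leviCivitaHom hg hY _ = ∑ i ∈ s, c i • leviCivitaHom hg hY _
  simp

/-- The Levi-Civita connection is metric. -/
theorem mvfderiv_inner (hg : IsSmoothMetric g) (hY : DiffFieldAt Y x) (hZ : DiffFieldAt Z x)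
    (v : TangentSpace 𝓘(ℝ, E) x) :
    mvfderiv 𝓘(ℝ, E) (fun y => g.inner y (Y y) (Z y)) x v
      = g.inner x (leviCivita g x v Y) (Z x) + g.inner x (Y x) (leviCivita g x v Z) := by
  have hv := (smoothFieldAt_extend v).diffFieldAt
  have h1 := two_mul_inner_leviCivita hg hv hY hZ
  have h2 := two_mul_inner_leviCivita hg hv hZ hY
  rw [FiberBundle.extend_apply_self] at h1 h2
  rw [g.symm x (Y x)]
  simp only [koszul, FiberBundle.extend_apply_self] at h1 h2
  simp only [g.symm _ (Z _) (Y _), g.symm _ (Z _) (FiberBundle.extend E v _),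
    g.symm _ (Y _) (FiberBundle.extend E v _)] at h1 h2
  rw [mlieBracket_swap_apply (V := Z) (W := Y)] at h2
  simp only [map_neg, neg_apply] at h2
  linarith

/-- The Levi-Civita connection is torsion-free. -/
theorem leviCivita_sub_leviCivita (hg : IsSmoothMetric g) (hX : DiffFieldAt X x)
    (hY : DiffFieldAt Y x) :
    leviCivita g x (X x) Y - leviCivita g x (Y x) X = mlieBracket 𝓘(ℝ, E) X Y x := by
  refine eq_of_inner_eq (g := g) fun z => ?_
  have hz := (smoothFieldAt_extend z).diffFieldAt
  have h1 := two_mul_inner_leviCivita hg hX hY hz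
  have h2 := two_mul_inner_leviCivita hg hY hX hz
  simp only [koszul, FiberBundle.extend_apply_self] at h1 h2
  simp only [g.symm _ (Y _) (X _), g.symm _ (FiberBundle.extend E z _) (X _),
    g.symm _ (FiberBundle.extend E z _) (Y _)] at h1 h2
  rw [mlieBracket_swap_apply (V := Y) (W := X)] at h2
  simp only [map_neg, neg_apply] at h2
  rw [map_sub, sub_apply]
  linarith

/-- The Leibniz rule follows from metric compatibility: g(f Y, Z) is differentiated once as an inner
product and once as f times a function. -/
theorem leviCivita_smul (hg : IsSmoothMetric g) {f : M → ℝ}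
    (hf : MDifferentiableAt 𝓘(ℝ, E) 𝓘(ℝ, ℝ) f x) (hY : DiffFieldAt Y x)
    (v : TangentSpace 𝓘(ℝ, E) x) :
    leviCivita g x v (fun y => f y • Y y)
      = mvfderiv 𝓘(ℝ, E) f x v • Y x + f x • leviCivita g x v Y := by
  refine eq_of_inner_eq (g := g) fun z => ?_
  have hz := (smoothFieldAt_extend z).diffFieldAt
  have h1 := mvfderiv_inner hg hY hz v
  have h2 := mvfderiv_inner hg (hY.smul hf) hz v
  have h3 : (fun y => g.inner y (f y • Y y) (FiberBundle.extend E z y))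
    = fun y => f y * g.inner y (Y y) (FiberBundle.extend E z y) := by ext y; simp
  rw [h3, mvfderiv_fun_mul hf (hg.mdifferentiableAt hY hz)] at h2
  simp only [add_apply, smul_apply, h1, smul_eq_mul, map_smul, FiberBundle.extend_apply_self] at h2
  simp only [add_apply, smul_apply, smul_eq_mul, map_smul, map_add]
  linarith

theorem leviCivita_add (hg : IsSmoothMetric g) (hX : DiffFieldAt X x) (hY : DiffFieldAt Y x)
    (v : TangentSpace 𝓘(ℝ, E) x) :
    leviCivita g x v (fun y => X y + Y y) = leviCivita g x v X + leviCivita g x v Y := by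
  refine eq_of_inner_eq (g := g) fun z => ?_
  have hz := (smoothFieldAt_extend z).diffFieldAt
  have h0 := mvfderiv_inner hg hX hz v
  have h1 := mvfderiv_inner hg hY hz v
  have h2 := mvfderiv_inner hg (hX.add hY) hz v
  have h3 : (fun y => g.inner y (X y + Y y) (FiberBundle.extend E z y))
    = fun y => g.inner y (X y) (FiberBundle.extend E z y)
      + g.inner y (Y y) (FiberBundle.extend E z y) := by ext y; simp
  rw [h3, mvfderiv_fun_add (hg.mdifferentiableAt hX hz) (hg.mdifferentiableAt hY hz)] at h2
  simp only [add_apply, h0, h1, map_add, FiberBundle.extend_apply_self] at h2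
  simp only [add_apply, map_add]
  linarith

/-- The definition by `Classical.epsilon` gives no regularity. In a smooth orthonormal frame the
coefficients are halves of Koszul expressions, which are smooth. -/
theorem SmoothFieldAt.leviCivita (hg : IsSmoothMetric g) (hX : SmoothFieldAt X x)
    (hY : SmoothFieldAt Y x) : SmoothFieldAt (fun y => leviCivita g y (X y) Y) x := by
  obtain ⟨e, he, heb⟩ := exists_isOrthonormalFrameAt hg x
  have hk : ∀ i, ContMDiffAt 𝓘(ℝ, E) 𝓘(ℝ, ℝ) ∞ (fun y => (1 / 2) * koszul g X Y (e i) y) x := by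
    intro i
    refine contMDiffAt_const.mul ?_
    exact (((((ContMDiffAt.mvfderiv_apply (hg.contMDiffAt hY (he i)) hX).add
      (ContMDiffAt.mvfderiv_apply (hg.contMDiffAt (he i) hX) hY)).sub
      (ContMDiffAt.mvfderiv_apply (hg.contMDiffAt hX hY) (he i))).add
      (hg.contMDiffAt (hX.mlieBracket hY) (he i))).sub
      (hg.contMDiffAt (hX.mlieBracket (he i)) hY)).sub
      (hg.contMDiffAt (hY.mlieBracket (he i)) hX)
  refine (SmoothFieldAt.sum (s := Finset.univ) fun i => (he i).smul (hk i)).congr ?_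
  have hed : ∀ᶠ y in 𝓝 x, ∀ i, DiffFieldAt (e i) y :=
    Filter.eventually_all.2 fun i => (he i).eventually_diffFieldAt
  filter_upwards [hX.eventually_diffFieldAt, hY.eventually_diffFieldAt, hed, heb]
    with y hXy hYy hey hby
  rw [← hby.sum_eq (_root_.leviCivita g y (X y) Y) trivial]
  refine Finset.sum_congr rfl fun i _ => ?_
  rw [← two_mul_inner_leviCivita hg hXy hYy (hey i), g.symm]
  congr 1
  ring

/-- `TensorialAt` tests against merely differentiable fields, so X cannot be assumed smooth here.
Expanding X in a smooth frame moves its coefficients out of the direction slot. -/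
theorem DiffFieldAt.leviCivita (hg : IsSmoothMetric g) (hX : DiffFieldAt X x)
    (hY : SmoothFieldAt Y x) : DiffFieldAt (fun y => leviCivita g y (X y) Y) x := by
  obtain ⟨e, he, heb⟩ := exists_isOrthonormalFrameAt hg x
  refine (DiffFieldAt.sum (s := Finset.univ) fun i => ((he i).leviCivita hg hY).diffFieldAt.smul
    (hg.mdifferentiableAt (he i).diffFieldAt hX)).congr ?_
  filter_upwards [hY.eventually_diffFieldAt, heb] with y hYy hby
  conv_lhs => rw [← hby.sum_eq (X y) trivial]
  rw [leviCivita_sum_left hg hYy]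

/-! ### The curvature tensor -/

/-- The Lie bracket acts on functions as the commutator of derivations. -/
theorem mvfderiv_mlieBracket {f : M → ℝ} (hf : ContMDiffAt 𝓘(ℝ, E) 𝓘(ℝ, ℝ) ∞ f x)
    (hX : SmoothFieldAt X x) (hY : SmoothFieldAt Y x) :
    mvfderiv 𝓘(ℝ, E) f x (mlieBracket 𝓘(ℝ, E) X Y x)
      = mvfderiv 𝓘(ℝ, E) (fun y => mvfderiv 𝓘(ℝ, E) f y (Y y)) x (X x)
        - mvfderiv 𝓘(ℝ, E) (fun y => mvfderiv 𝓘(ℝ, E) f y (X y)) x (Y x) := by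
  have : CompleteSpace E := FiniteDimensional.complete ℝ E
  rcases subsingleton_or_nontrivial E with hE | hE
  · have h0 : ∀ v : TangentSpace 𝓘(ℝ, E) x, v = 0 := fun v => hE.elim (α := E) v 0
    rw [h0 (mlieBracket 𝓘(ℝ, E) X Y x), h0 (X x), h0 (Y x)]
    simp
  obtain ⟨w, hw⟩ : ∃ w : TangentSpace 𝓘(ℝ, E) x, w ≠ 0 := exists_ne (α := E) 0
  have : IsManifold 𝓘(ℝ, E) (minSmoothness ℝ 3) M := by
    rw [minSmoothness_of_isRCLikeNormedField]; infer_instance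
  have hle : ∀ {V : ∀ x : M, TangentSpace 𝓘(ℝ, E) x}, SmoothFieldAt V x →
      ContMDiffAt 𝓘(ℝ, E) 𝓘(ℝ, E).tangent (minSmoothness ℝ 2)
        (fun y => (⟨y, V y⟩ : TangentBundle 𝓘(ℝ, E) M)) x := fun h =>
    ContMDiffAt.of_le h (by rw [minSmoothness_of_isRCLikeNormedField]; exact ENat.LEInfty.out)
  -- The Jacobi identity for X, Y, f W is compared with f times the one for X, Y, W. What remains is
  -- the desired identity multiplied by W, and W does not vanish at `x`.
  set W : ∀ x : M, TangentSpace 𝓘(ℝ, E) x := FiberBundle.extend E w with hWdef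
  have hW : SmoothFieldAt W x := smoothFieldAt_extend w
  have hfW : SmoothFieldAt (f • W) x := hW.smul hf
  have hfd : MDifferentiableAt 𝓘(ℝ, E) 𝓘(ℝ, ℝ) f x := hf.mdifferentiableAt (by simp)
  have hbr : ∀ {V : ∀ x : M, TangentSpace 𝓘(ℝ, E) x},
      mlieBracket 𝓘(ℝ, E) V (f • W) =ᶠ[𝓝 x] (fun y => mvfderiv 𝓘(ℝ, E) f y (V y)) • W
        + f • mlieBracket 𝓘(ℝ, E) V W := by
    intro V
    filter_upwards [hf.eventually_mdifferentiableAt, hW.eventually_diffFieldAt] with y h1 h2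
    exact mlieBracket_smul_right h1 h2
  have hex : ∀ {U V : ∀ x : M, TangentSpace 𝓘(ℝ, E) x}, SmoothFieldAt V x →
      mlieBracket 𝓘(ℝ, E) U (mlieBracket 𝓘(ℝ, E) V (f • W)) x
        = (mvfderiv 𝓘(ℝ, E) (fun y => mvfderiv 𝓘(ℝ, E) f y (V y)) x (U x)) • W x
          + mvfderiv 𝓘(ℝ, E) f x (V x) • mlieBracket 𝓘(ℝ, E) U W x
          + (mvfderiv 𝓘(ℝ, E) f x (U x) • mlieBracket 𝓘(ℝ, E) V W x
          + f x • mlieBracket 𝓘(ℝ, E) U (mlieBracket 𝓘(ℝ, E) V W) x) := by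
    intro U V hV
    have hVf : MDifferentiableAt 𝓘(ℝ, E) 𝓘(ℝ, ℝ) (fun y => mvfderiv 𝓘(ℝ, E) f y (V y)) x :=
      (hf.mvfderiv_apply hV).mdifferentiableAt (by simp)
    rw [(Filter.EventuallyEq.refl _ U).mlieBracket_vectorField_eq hbr,
      mlieBracket_add_right (W := (fun y => mvfderiv 𝓘(ℝ, E) f y (V y)) • W)
        (W₁ := f • mlieBracket 𝓘(ℝ, E) V W) (hW.diffFieldAt.smul hVf) ((hV.mlieBracket hW).diffFieldAt.smul hfd),
      mlieBracket_smul_right hVf hW.diffFieldAt,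
      mlieBracket_smul_right hfd (hV.mlieBracket hW).diffFieldAt]
  have hJ := leibniz_identity_mlieBracket_apply (hle hX) (hle hY) (hle hfW)
  have hJ' := leibniz_identity_mlieBracket_apply (hle hX) (hle hY) (hle hW)
  rw [hex hY, hex hX, hJ', mlieBracket_smul_right hfd hW.diffFieldAt] at hJ
  have hWx : W x = w := FiberBundle.extend_apply_self E w
  rw [hWx] at hJ
  have h : (mvfderiv 𝓘(ℝ, E) f x (mlieBracket 𝓘(ℝ, E) X Y x)
      - (mvfderiv 𝓘(ℝ, E) (fun y => mvfderiv 𝓘(ℝ, E) f y (Y y)) x (X x)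
        - mvfderiv 𝓘(ℝ, E) (fun y => mvfderiv 𝓘(ℝ, E) f y (X y)) x (Y x))) • w = 0 := by
    rw [← sub_eq_zero] at hJ
    rw [← neg_eq_zero, ← hJ]
    module
  exact sub_eq_zero.1 ((smul_eq_zero.1 h).resolve_right hw)

theorem mvfderiv_mvfderiv_inner (hg : IsSmoothMetric g) (hY : SmoothFieldAt Y x)
    (hZ : SmoothFieldAt Z x) (hW : SmoothFieldAt W x)
    (v : TangentSpace 𝓘(ℝ, E) x) :
    mvfderiv 𝓘(ℝ, E)
        (fun y => mvfderiv 𝓘(ℝ, E) (fun y => g.inner y (Z y) (W y)) y (Y y)) x v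
      = g.inner x (leviCivita g x v (fun y => leviCivita g y (Y y) Z)) (W x)
        + g.inner x (leviCivita g x (Y x) Z) (leviCivita g x v W)
        + (g.inner x (leviCivita g x v Z) (leviCivita g x (Y x) W)
          + g.inner x (Z x) (leviCivita g x v (fun y => leviCivita g y (Y y) W))) := by
  have h : (fun y => mvfderiv 𝓘(ℝ, E) (fun y => g.inner y (Z y) (W y)) y (Y y)) =ᶠ[𝓝 x]
      fun y => g.inner y (leviCivita g y (Y y) Z) (W y)
        + g.inner y (Z y) (leviCivita g y (Y y) W) := by
    filter_upwards [hZ.eventually_diffFieldAt, hW.eventually_diffFieldAt] with y h1 h2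
    exact mvfderiv_inner hg h1 h2 _
  have hZ' := hZ.diffFieldAt
  have hW' := hW.diffFieldAt
  have h1 := (hY.leviCivita hg hZ).diffFieldAt
  have h2 := (hY.leviCivita hg hW).diffFieldAt
  rw [mvfderiv_congr_of_eventuallyEq h,
    mvfderiv_fun_add (hg.mdifferentiableAt h1 hW') (hg.mdifferentiableAt hZ' h2), add_apply,
    mvfderiv_inner hg h1 hW', mvfderiv_inner hg hZ' h2]

/-- The commutator of X and Y acting on the function g(Z, W) equals the derivative along [X, Y];
after metric compatibility is applied twice, the mixed first-order terms cancel and the curvature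
terms remain. -/
theorem inner_curvature_swap_right (hg : IsSmoothMetric g) (hX : SmoothFieldAt X x)
    (hY : SmoothFieldAt Y x) (hZ : SmoothFieldAt Z x) (hW : SmoothFieldAt W x) :
    g.inner x (curvature g X Y Z x) (W x) = - g.inner x (curvature g X Y W x) (Z x) := by
  have h := mvfderiv_mlieBracket (hg.contMDiffAt hZ hW) hX hY
  rw [mvfderiv_mvfderiv_inner hg hY hZ hW, mvfderiv_mvfderiv_inner hg hX hZ hW,
    mvfderiv_inner hg hZ.diffFieldAt hW.diffFieldAt] at h
  simp only [curvature, map_add, map_sub, add_apply, sub_apply]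
  simp only [g.symm x (Z x)] at h
  linarith

theorem curvature_swap (hg : IsSmoothMetric g) (hZ : DiffFieldAt Z x) :
    curvature g X Y Z x = - curvature g Y X Z x := by
  have h : leviCivita g x (mlieBracket 𝓘(ℝ, E) X Y x) Z
      = - leviCivita g x (mlieBracket 𝓘(ℝ, E) Y X x) Z := by
    rw [mlieBracket_swap_apply]
    exact (leviCivitaHom hg hZ).map_neg _
  rw [curvature, curvature, h]
  abel

/-- The term Y(f) ∇_X Z from ∇_Y (f ∇_X Z) cancels against the one from ∇ along [f X, Y]. -/
theorem tensorialAt_curvature (hg : IsSmoothMetric g) (hY : DiffFieldAt Y x)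
    (hZ : SmoothFieldAt Z x) :
    TensorialAt 𝓘(ℝ, E) E (fun X : ∀ x : M, TangentSpace 𝓘(ℝ, E) x => curvature g X Y Z x) x := by
  have : CompleteSpace E := FiniteDimensional.complete ℝ E
  constructor
  · intro f X hf hX
    have h : (fun y => leviCivita g y ((f • X) y) Z) =ᶠ[𝓝 x]
        fun y => f y • leviCivita g y (X y) Z := by
      filter_upwards [hZ.eventually_diffFieldAt] with y hy
      exact leviCivita_smul_left hg hy _ _
    have h2 : leviCivita g x (mlieBracket 𝓘(ℝ, E) (f • X) Y x) Z
        = -(mvfderiv 𝓘(ℝ, E) f x (Y x)) • leviCivita g x (X x) Z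
          + f x • leviCivita g x (mlieBracket 𝓘(ℝ, E) X Y x) Z := by
      rw [mlieBracket_smul_left hf hX, leviCivita_add_left hg hZ.diffFieldAt,
        leviCivita_smul_left hg hZ.diffFieldAt, leviCivita_smul_left hg hZ.diffFieldAt]
    simp only [curvature]
    rw [leviCivita_congr h, leviCivita_smul hg hf (DiffFieldAt.leviCivita hg hX hZ), h2, Pi.smul_apply',
      leviCivita_smul_left hg (hY.leviCivita hg hZ)]
    module
  · intro X X' hX hX'
    have h : (fun y => leviCivita g y ((X + X') y) Z) =ᶠ[𝓝 x]
        fun y => leviCivita g y (X y) Z + leviCivita g y (X' y) Z := by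
      filter_upwards [hZ.eventually_diffFieldAt] with y hy
      exact leviCivita_add_left hg hy _ _
    simp only [curvature]
    rw [leviCivita_congr h, leviCivita_add hg (DiffFieldAt.leviCivita hg hX hZ)
      (DiffFieldAt.leviCivita hg hX' hZ),
      Pi.add_apply, leviCivita_add_left hg (hY.leviCivita hg hZ), mlieBracket_add_left hX hX',
      leviCivita_add_left hg hZ.diffFieldAt]
    abel

/-- The value `g(R(X, Y) Z, W)` at `x` depends on the values of the vector fields at `x` only. -/
theorem inner_curvature_congr (hg : IsSmoothMetric g)
    {X' Y' Z' : ∀ x : M, TangentSpace 𝓘(ℝ, E) x} (hX : SmoothFieldAt X x) (hX' : SmoothFieldAt X' x)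
    (hY : SmoothFieldAt Y x) (hY' : SmoothFieldAt Y' x) (hZ : SmoothFieldAt Z x)
    (hZ' : SmoothFieldAt Z' x) (h1 : X x = X' x) (h2 : Y x = Y' x) (h3 : Z x = Z' x) :
    curvature g X Y Z x = curvature g X' Y' Z' x := by
  have e1 : curvature g X Y Z x = curvature g X' Y Z x :=
    (tensorialAt_curvature hg hY.diffFieldAt hZ).pointwise hX.diffFieldAt hX'.diffFieldAt h1
  have e2 : curvature g X' Y Z x = curvature g X' Y' Z x := by
    rw [curvature_swap hg hZ.diffFieldAt, curvature_swap hg hZ.diffFieldAt (Y := Y')]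
    congr 1
    exact (tensorialAt_curvature hg hX'.diffFieldAt hZ).pointwise hY.diffFieldAt hY'.diffFieldAt h2
  rw [e1, e2]
  -- Pairing with `w` and using skew-symmetry moves Z out of the differentiated slot, so that only
  -- its value at `x` enters.
  refine eq_of_inner_eq (g := g) fun w => ?_
  have hw := smoothFieldAt_extend w
  have h4 := inner_curvature_swap_right hg hX' hY' hZ hw
  have h5 := inner_curvature_swap_right hg hX' hY' hZ' hw
  rw [FiberBundle.extend_apply_self] at h4 h5
  rw [h4, h5, h3]

/-- The curvature operator `R(v, w)` at `x`, applied to `z`. -/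
noncomputable def curvatureAt (g : TangentMetric E M) (x : M) (v w z : TangentSpace 𝓘(ℝ, E) x) :
    TangentSpace 𝓘(ℝ, E) x :=
  curvature g (FiberBundle.extend E v) (FiberBundle.extend E w) (FiberBundle.extend E z) x

theorem curvatureAt_eq (hg : IsSmoothMetric g) (hX : SmoothFieldAt X x) (hY : SmoothFieldAt Y x)
    (hZ : SmoothFieldAt Z x) : curvatureAt g x (X x) (Y x) (Z x) = curvature g X Y Z x :=
  inner_curvature_congr hg (smoothFieldAt_extend _) hX (smoothFieldAt_extend _) hY
    (smoothFieldAt_extend _) hZ (by simp) (by simp) (by simp)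

theorem curvatureAt_add (hg : IsSmoothMetric g) (v v' w z : TangentSpace 𝓘(ℝ, E) x) :
    curvatureAt g x (v + v') w z = curvatureAt g x v w z + curvatureAt g x v' w z := by
  have hv := (smoothFieldAt_extend v).diffFieldAt
  have hv' := (smoothFieldAt_extend v').diffFieldAt
  have hT := tensorialAt_curvature hg (smoothFieldAt_extend w).diffFieldAt (smoothFieldAt_extend z)
  unfold curvatureAt
  rw [← hT.add hv hv']
  exact hT.pointwise (smoothFieldAt_extend _).diffFieldAt (hv.add hv') (by simp)

theorem curvatureAt_smul (hg : IsSmoothMetric g) (c : ℝ) (v w z : TangentSpace 𝓘(ℝ, E) x) :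
    curvatureAt g x (c • v) w z = c • curvatureAt g x v w z := by
  have hv := (smoothFieldAt_extend v).diffFieldAt
  have hT := tensorialAt_curvature hg (smoothFieldAt_extend w).diffFieldAt (smoothFieldAt_extend z)
  have hc : MDifferentiableAt 𝓘(ℝ, E) 𝓘(ℝ, ℝ) (fun _ : M => c) x := mdifferentiableAt_const
  unfold curvatureAt
  rw [← hT.smul hc hv]
  exact hT.pointwise (smoothFieldAt_extend _).diffFieldAt (hv.smul hc) (by simp)

theorem curvatureAt_swap (hg : IsSmoothMetric g) (v w z : TangentSpace 𝓘(ℝ, E) x) :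
    curvatureAt g x v w z = - curvatureAt g x w v z :=
  curvature_swap hg (smoothFieldAt_extend z).diffFieldAt

theorem inner_curvatureAt_swap_right (hg : IsSmoothMetric g) (v w z t : TangentSpace 𝓘(ℝ, E) x) :
    g.inner x (curvatureAt g x v w z) t = - g.inner x (curvatureAt g x v w t) z := by
  have h := inner_curvature_swap_right hg (smoothFieldAt_extend v) (smoothFieldAt_extend w)
    (smoothFieldAt_extend z) (smoothFieldAt_extend t)
  simpa [curvatureAt] using h

theorem sectionalCurvature_eq (hg : IsSmoothMetric g) (hX : SmoothFieldAt X x)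
    (hY : SmoothFieldAt Y x) :
    sectionalCurvature g x (X x) (Y x) = g.inner x (curvature g X Y X x) (Y x) := by
  rw [← curvatureAt_eq hg hX hY hX]
  rfl

/-- The sum of the sectional curvatures `K(v, w)` over orthonormal bases of two subspaces does not
depend on the bases. -/
theorem sum_sectionalCurvature_eq (hg : IsSmoothMetric g)
    {V W : Submodule ℝ (TangentSpace 𝓘(ℝ, E) x)}
    {ι ι' κ κ' : Type*} [Fintype ι] [DecidableEq ι] [Fintype ι'] [DecidableEq ι']
    [Fintype κ] [DecidableEq κ] [Fintype κ'] [DecidableEq κ']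
    {b : ι → TangentSpace 𝓘(ℝ, E) x} {b' : ι' → TangentSpace 𝓘(ℝ, E) x}
    {c : κ → TangentSpace 𝓘(ℝ, E) x} {c' : κ' → TangentSpace 𝓘(ℝ, E) x}
    (hb : IsOrthonormalBasisOf g x V b) (hb' : IsOrthonormalBasisOf g x V b')
    (hc : IsOrthonormalBasisOf g x W c) (hc' : IsOrthonormalBasisOf g x W c') :
    ∑ i, ∑ j, sectionalCurvature g x (b i) (c j)
      = ∑ i, ∑ j, sectionalCurvature g x (b' i) (c' j) := by
  -- For fixed `w`, the curvature K(v, w) = -g(R(v, w) w, v) is the diagonal of a form bilinear in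
  -- the two occurrences of `v`, so its sum over a basis is a trace. The skew-symmetries are needed
  -- to bring it to this shape.
  have h1 : ∀ w, ∑ i, sectionalCurvature g x (b i) w = ∑ i, sectionalCurvature g x (b' i) w := by
    intro w
    have h := hb.trace_eq hb' (LinearMap.mk₂ ℝ
      (fun v z => g.inner x (curvatureAt g x v w w) z)
      (fun v v' z => by rw [curvatureAt_add hg, map_add, add_apply])
      (fun c v z => by rw [curvatureAt_smul hg, map_smul, smul_apply])
      (fun v z z' => map_add _ _ _) (fun c v z => map_smul _ _ _))
    simp only [LinearMap.mk₂_apply] at h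
    have hK : ∀ v, sectionalCurvature g x v w = - g.inner x (curvatureAt g x v w w) v :=
      fun v => inner_curvatureAt_swap_right hg v w v w
    simp only [hK, Finset.sum_neg_distrib, h]
  have h2 : ∀ v, ∑ j, sectionalCurvature g x v (c j) = ∑ j, sectionalCurvature g x v (c' j) := by
    intro v
    have h := hc.trace_eq hc' (LinearMap.mk₂ ℝ
      (fun w z => g.inner x (curvatureAt g x w v v) z)
      (fun v v' z => by rw [curvatureAt_add hg, map_add, add_apply])
      (fun c v z => by rw [curvatureAt_smul hg, map_smul, smul_apply])
      (fun v z z' => map_add _ _ _) (fun c v z => map_smul _ _ _))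
    simp only [LinearMap.mk₂_apply] at h
    have hK : ∀ w, sectionalCurvature g x v w = - g.inner x (curvatureAt g x w v v) w := by
      intro w
      have h0 : sectionalCurvature g x v w = g.inner x (curvatureAt g x v w v) w := rfl
      rw [h0, curvatureAt_swap hg, map_neg, neg_apply]
    simp only [hK, Finset.sum_neg_distrib, h]
  simp only [h2]
  rw [Finset.sum_comm]
  simp only [h1]
  rw [Finset.sum_comm]

end LeviCivita

/-! ### Chain rules and foliated charts -/

section Composition

variable {E : Type*} [NormedAddCommGroup E] [NormedSpace ℝ E]
  {M : Type*} [TopologicalSpace M] [ChartedSpace E M]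
  {G : Type*} [NormedAddCommGroup G] [NormedSpace ℝ G]
  {G' : Type*} [NormedAddCommGroup G'] [NormedSpace ℝ G']

theorem mvfderiv_comp_eq_fderiv {f : M → G} {h : G → G'} {x : M}
    (hh : DifferentiableAt ℝ h (f x)) (hf : MDifferentiableAt 𝓘(ℝ, E) 𝓘(ℝ, G) f x)
    (v : TangentSpace 𝓘(ℝ, E) x) :
    mvfderiv 𝓘(ℝ, E) (fun y => h (f y)) x v = fderiv ℝ h (f x) (mvfderiv 𝓘(ℝ, E) f x v) := by
  have h1 := mfderiv_comp x hh.mdifferentiableAt hf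
  rw [mfderiv_eq_fderiv] at h1
  exact congrArg (fun L => L v) h1

theorem mvfderiv_clm_comp {f : M → G} (L : G →L[ℝ] G') {x : M}
    (hf : MDifferentiableAt 𝓘(ℝ, E) 𝓘(ℝ, G) f x) (v : TangentSpace 𝓘(ℝ, E) x) :
    mvfderiv 𝓘(ℝ, E) (fun y => L (f y)) x v = L (mvfderiv 𝓘(ℝ, E) f x v) := by
  rw [mvfderiv_comp_eq_fderiv L.differentiableAt hf, L.fderiv]

theorem mvfderiv_eq_of_eventuallyEq {f f' : M → G} {x : M} (h : f =ᶠ[𝓝 x] f')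
    (v : TangentSpace 𝓘(ℝ, E) x) : mvfderiv 𝓘(ℝ, E) f x v = mvfderiv 𝓘(ℝ, E) f' x v := by
  unfold mvfderiv
  rw [h.mfderiv_eq, h.eq_of_nhds]

end Composition

namespace Foliation

variable {p n : ℕ} {E : Type*} [NormedAddCommGroup E] [NormedSpace ℝ E]
  {M : Type*} [TopologicalSpace M] [ChartedSpace E M]
  {F : Foliation p n E M} {x : M}
  {e : OpenPartialHomeomorph M (EuclideanSpace ℝ (Fin p) × EuclideanSpace ℝ (Fin n))}

theorem mdifferentiable_chart (he : e ∈ F.atlas) : e.MDifferentiable 𝓘(ℝ, E)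
    𝓘(ℝ, EuclideanSpace ℝ (Fin p) × EuclideanSpace ℝ (Fin n)) :=
  ⟨(F.contMDiffOn_toFun e he).mdifferentiableOn (by simp),
    (F.contMDiffOn_symm e he).mdifferentiableOn (by simp)⟩

theorem contMDiffAt_chart (he : e ∈ F.atlas) (hx : x ∈ e.source) : ContMDiffAt 𝓘(ℝ, E)
    𝓘(ℝ, EuclideanSpace ℝ (Fin p) × EuclideanSpace ℝ (Fin n)) ∞ e x :=
  (F.contMDiffOn_toFun e he).contMDiffAt (e.open_source.mem_nhds hx)

theorem mdifferentiableAt_chart (he : e ∈ F.atlas) (hx : x ∈ e.source) : MDifferentiableAt 𝓘(ℝ, E)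
    𝓘(ℝ, EuclideanSpace ℝ (Fin p) × EuclideanSpace ℝ (Fin n)) e x :=
  (mdifferentiable_chart he).mdifferentiableAt hx

/-- The differential of a foliated chart. -/
noncomputable def chartDeriv (he : e ∈ F.atlas) (hx : x ∈ e.source) :
    TangentSpace 𝓘(ℝ, E) x ≃L[ℝ] EuclideanSpace ℝ (Fin p) × EuclideanSpace ℝ (Fin n) :=
  ((mdifferentiable_chart he).mfderiv hx).trans (NormedSpace.fromTangentSpace (e x))

theorem chartDeriv_apply (he : e ∈ F.atlas) (hx : x ∈ e.source) (v : TangentSpace 𝓘(ℝ, E) x) :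
    chartDeriv he hx v = mvfderiv 𝓘(ℝ, E) e x v := rfl

theorem mvfderiv_snd_chart (he : e ∈ F.atlas) (hx : x ∈ e.source) (v : TangentSpace 𝓘(ℝ, E) x) :
    mvfderiv 𝓘(ℝ, E) (fun y => (e y).2) x v = (chartDeriv he hx v).2 :=
  mvfderiv_clm_comp (ContinuousLinearMap.snd ℝ (EuclideanSpace ℝ (Fin p))
    (EuclideanSpace ℝ (Fin n))) (mdifferentiableAt_chart he hx) v

/-- A function that is constant on the plaque through `x` of a foliated chart has zero derivative
in the directions of the plaque. -/
theorem mvfderiv_eq_zero_of_constant_on_plaque {G : Type*} [NormedAddCommGroup G] [NormedSpace ℝ G]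
    (he : e ∈ F.atlas) (hx : x ∈ e.source) {f : M → G}
    (hf : MDifferentiableAt 𝓘(ℝ, E) 𝓘(ℝ, G) f x) {U : Set M} (hU : U ∈ 𝓝 x)
    (hconst : ∀ y ∈ U, (e y).2 = (e x).2 → f y = f x) {v : TangentSpace 𝓘(ℝ, E) x}
    (hv : (chartDeriv he hx v).2 = 0) : mvfderiv 𝓘(ℝ, E) f x v = 0 := by
  set h : EuclideanSpace ℝ (Fin p) × EuclideanSpace ℝ (Fin n) → G := fun w => f (e.symm w) with hh
  set w := chartDeriv he hx v with hw
  have hsx : e.symm (e x) = x := e.left_inv hx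
  have hhd : DifferentiableAt ℝ h (e x) := by
    rw [← mdifferentiableAt_iff_differentiableAt]
    have h1 := (mdifferentiable_chart he).mdifferentiableAt_symm (e.map_source hx)
    have h2 : MDifferentiableAt 𝓘(ℝ, E) 𝓘(ℝ, G) f (e.symm (e x)) := by rwa [hsx]
    exact h2.comp _ h1
  have h1 : f =ᶠ[𝓝 x] fun y => h (e y) := by
    filter_upwards [e.open_source.mem_nhds hx] with y hy
    simp [hh, e.left_inv hy]
  rw [mvfderiv_eq_of_eventuallyEq h1, mvfderiv_comp_eq_fderiv hhd (mdifferentiableAt_chart he hx),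
    ← chartDeriv_apply he hx, ← hw]
  -- In the chart, the derivative is taken along the straight line in direction `w`. The transverse
  -- part of `w` is zero, so the line stays in the slice and the function is constant along it near
  -- 0.
  have hline : HasDerivAt (fun t : ℝ => h (e x + t • w)) (fderiv ℝ h (e x) w) 0 := by
    have h2 : HasDerivAt (fun t : ℝ => e x + t • w) w 0 := by
      simpa using ((hasDerivAt_id (0 : ℝ)).smul_const w).const_add (e x)
    have h3 : HasFDerivAt h (fderiv ℝ h (e x)) (e x + (0 : ℝ) • w) := by
      simpa using hhd.hasFDerivAt
    exact h3.comp_hasDerivAt (0 : ℝ) h2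
  have hc : Filter.Tendsto (fun t : ℝ => e x + t • w) (𝓝 0) (𝓝 (e x)) := by
    have : Continuous fun t : ℝ => e x + t • w := by fun_prop
    simpa using this.tendsto 0
  have hcs : Filter.Tendsto e.symm (𝓝 (e x)) (𝓝 x) := by
    have := e.continuousAt_symm (e.map_source hx)
    rwa [ContinuousAt, hsx] at this
  have hev : (fun t : ℝ => h (e x + t • w)) =ᶠ[𝓝 0] fun _ => f x := by
    filter_upwards [hc (e.open_target.mem_nhds (e.map_source hx)), hc (hcs hU)] with t ht htU
    refine hconst _ htU ?_
    rw [e.right_inv ht]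
    simp [hv]
  exact hline.unique ((hasDerivAt_const (0 : ℝ) (f x)).congr_of_eventuallyEq hev)

/-- One chart suffices: by compatibility, the transverse coordinate of any other chart is locally
constant along the plaques of this one, so its differential kills the same vectors. -/
theorem mem_tangent_iff (he : e ∈ F.atlas) (hx : x ∈ e.source) {v : TangentSpace 𝓘(ℝ, E) x} :
    v ∈ F.tangent x ↔ (chartDeriv he hx v).2 = 0 := by
  simp only [tangent, Submodule.mem_iInf, LinearMap.mem_ker]
  constructor
  · intro h
    rw [← mvfderiv_snd_chart he hx]
    exact h e ⟨he, hx⟩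
  · rintro hv e' ⟨he', hx'⟩
    obtain ⟨U, hU, hc⟩ := F.compatible e he e' he' x ⟨hx, hx'⟩
    refine mvfderiv_eq_zero_of_constant_on_plaque he hx ?_ hU
      (fun y hy h => hc y hy x (mem_of_mem_nhds hU) h) hv
    exact (ContinuousLinearMap.snd ℝ (EuclideanSpace ℝ (Fin p))
      (EuclideanSpace ℝ (Fin n))).differentiableAt.mdifferentiableAt.comp x
      (mdifferentiableAt_chart he' hx')

theorem IsLeafwiseConstant.mvfderiv_eq_zero {u : M → ℝ} (h : F.IsLeafwiseConstant u)
    (hu : MDifferentiableAt 𝓘(ℝ, E) 𝓘(ℝ, ℝ) u x) {v : TangentSpace 𝓘(ℝ, E) x}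
    (hv : v ∈ F.tangent x) : mvfderiv 𝓘(ℝ, E) u x v = 0 := by
  obtain ⟨e, he, hx⟩ := F.cover x
  refine mvfderiv_eq_zero_of_constant_on_plaque he hx hu (e.open_source.mem_nhds hx) ?_
    ((mem_tangent_iff he hx).1 hv)
  intro y hy hyx
  exact h x y (.single ⟨e, he, hx, hy, hyx.symm⟩)

theorem finrank_model (F : Foliation p n E M) (x : M) : Module.finrank ℝ E = p + n := by
  obtain ⟨e, he, hx⟩ := F.cover x
  have h := (chartDeriv he hx).toLinearEquiv.finrank_eq
  rw [Module.finrank_prod, finrank_euclideanSpace_fin, finrank_euclideanSpace_fin] at h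
  exact h

theorem finrank_tangent [FiniteDimensional ℝ E] (F : Foliation p n E M) (x : M) :
    Module.finrank ℝ (F.tangent x) = p := by
  obtain ⟨e, he, hx⟩ := F.cover x
  have : FiniteDimensional ℝ (TangentSpace 𝓘(ℝ, E) x) := inferInstanceAs (FiniteDimensional ℝ E)
  set L : TangentSpace 𝓘(ℝ, E) x →ₗ[ℝ] EuclideanSpace ℝ (Fin n) :=
    (LinearMap.snd ℝ _ _).comp (chartDeriv he hx).toLinearEquiv.toLinearMap with hL
  have hker : F.tangent x = LinearMap.ker L := by
    ext v
    rw [mem_tangent_iff he hx, LinearMap.mem_ker]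
    rfl
  have hrange : LinearMap.range L = ⊤ := by
    rw [LinearMap.range_eq_top]
    exact Prod.snd_surjective.comp (chartDeriv he hx).surjective
  have h := LinearMap.finrank_range_add_finrank_ker L
  rw [hrange, finrank_top, finrank_euclideanSpace_fin, ← hker] at h
  have h2 : Module.finrank ℝ (TangentSpace 𝓘(ℝ, E) x) = p + n := F.finrank_model x
  omega

theorem finrank_normal [FiniteDimensional ℝ E] (F : Foliation p n E M) (g : TangentMetric E M)
    (x : M) : Module.finrank ℝ (F.normal g x) = n := by
  have h := finrank_tangent_add_finrank_normal (F := F) (g := g) (x := x)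
  rw [F.finrank_tangent, F.finrank_model x] at h
  omega

variable [IsManifold 𝓘(ℝ, E) ∞ M] [FiniteDimensional ℝ E] {g : TangentMetric E M}

/-- Every tangent vector of a leaf extends to a smooth local section of the tangent
distribution. -/
theorem exists_smoothFieldAt_tangent {v : TangentSpace 𝓘(ℝ, E) x} (hv : v ∈ F.tangent x) :
    ∃ X : ∀ x : M, TangentSpace 𝓘(ℝ, E) x, SmoothFieldAt X x ∧ X x = v ∧
      ∀ᶠ y in 𝓝 x, X y ∈ F.tangent y := by
  have : CompleteSpace E := FiniteDimensional.complete ℝ E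
  obtain ⟨e, he, hx⟩ := F.cover x
  -- The extension is the pullback under the chart of the constant field `w`, whose transverse
  -- component is zero; it is therefore tangent on the whole chart domain.
  set w := chartDeriv he hx v with hw
  have hinv : ∀ {y} (hy : y ∈ e.source), mpullback 𝓘(ℝ, E)
      𝓘(ℝ, EuclideanSpace ℝ (Fin p) × EuclideanSpace ℝ (Fin n)) e (fun _ => w) y
      = (chartDeriv he hy).symm w := by
    intro y hy
    have h1 : mfderiv 𝓘(ℝ, E) 𝓘(ℝ, EuclideanSpace ℝ (Fin p) × EuclideanSpace ℝ (Fin n)) e y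
      = ((mdifferentiable_chart he).mfderiv hy : _ →L[ℝ] _) := rfl
    change (mfderiv 𝓘(ℝ, E) 𝓘(ℝ, EuclideanSpace ℝ (Fin p) × EuclideanSpace ℝ (Fin n)) e y).inverse w
      = _
    rw [h1, ContinuousLinearMap.inverse_equiv]
    rfl
  refine ⟨mpullback 𝓘(ℝ, E) 𝓘(ℝ, EuclideanSpace ℝ (Fin p) × EuclideanSpace ℝ (Fin n)) e
    (fun _ => w), ?_, ?_, ?_⟩
  · refine ContMDiffAt.mpullback_vectorField_preimage (n := ∞) ?_ (contMDiffAt_chart he hx)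
      ⟨(mdifferentiable_chart he).mfderiv hx, rfl⟩ (by simp)
    exact contMDiffAt_vectorSpace_iff_contDiffAt.2 contDiffAt_const
  · rw [hinv hx, hw]
    exact (chartDeriv he hx).symm_apply_apply v
  · filter_upwards [e.open_source.mem_nhds hx] with y hy
    rw [hinv hy, mem_tangent_iff he hy, ContinuousLinearEquiv.apply_symm_apply]
    exact (mem_tangent_iff he hx).1 hv

/-- The tangent distribution is involutive. -/
theorem mlieBracket_mem_tangent {X Y : ∀ x : M, TangentSpace 𝓘(ℝ, E) x} (hX : SmoothFieldAt X x)
    (hY : SmoothFieldAt Y x) (hXt : ∀ᶠ y in 𝓝 x, X y ∈ F.tangent y)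
    (hYt : ∀ᶠ y in 𝓝 x, Y y ∈ F.tangent y) : mlieBracket 𝓘(ℝ, E) X Y x ∈ F.tangent x := by
  obtain ⟨e, he, hx⟩ := F.cover x
  rw [mem_tangent_iff he hx]
  ext k
  -- `L ∘ e` is the `k`-th transverse coordinate. Both fields annihilate it near `x`, hence so does
  -- their commutator.
  set L : EuclideanSpace ℝ (Fin p) × EuclideanSpace ℝ (Fin n) →L[ℝ] ℝ :=
    (EuclideanSpace.proj k).comp (ContinuousLinearMap.snd ℝ _ _)
  have hf : ContMDiffAt 𝓘(ℝ, E) 𝓘(ℝ, ℝ) ∞ (fun y => L (e y)) x :=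
    L.contDiff.contMDiff.contMDiffAt.comp x (contMDiffAt_chart he hx)
  have hz : ∀ {Z : ∀ x : M, TangentSpace 𝓘(ℝ, E) x}, (∀ᶠ y in 𝓝 x, Z y ∈ F.tangent y) →
      (fun y => mvfderiv 𝓘(ℝ, E) (fun y => L (e y)) y (Z y)) =ᶠ[𝓝 x] fun _ => (0 : ℝ) := by
    intro Z hZ
    filter_upwards [hZ, e.open_source.mem_nhds hx] with y hy hys
    rw [mvfderiv_clm_comp L (mdifferentiableAt_chart he hys), ← chartDeriv_apply he hys]
    have := (mem_tangent_iff he hys).1 hy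
    change ((chartDeriv he hys (Z y)).2) k = 0
    rw [this]
    rfl
  have h := mvfderiv_mlieBracket hf hX hY
  rw [mvfderiv_congr_of_eventuallyEq (hz hXt), mvfderiv_congr_of_eventuallyEq (hz hYt),
    mvfderiv_const, zero_apply, zero_apply, sub_zero,
    mvfderiv_clm_comp L (mdifferentiableAt_chart he hx), ← chartDeriv_apply he hx] at h
  exact h

/-! ### Adapted frames -/

/-- `e` and `ε` are smooth local orthonormal frames of the tangent and of the normal distribution
around `x`. -/
structure IsAdaptedFrameAt (F : Foliation p n E M) (g : TangentMetric E M) (x : M)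
    {ι : Type*} [Fintype ι] [DecidableEq ι] {κ : Type*} [Fintype κ] [DecidableEq κ]
    (e : ι → ∀ x : M, TangentSpace 𝓘(ℝ, E) x) (ε : κ → ∀ x : M, TangentSpace 𝓘(ℝ, E) x) : Prop where
  smooth_tangent : ∀ a, SmoothFieldAt (e a) x
  smooth_normal : ∀ j, SmoothFieldAt (ε j) x
  basis_tangent : ∀ᶠ y in 𝓝 x, IsOrthonormalBasisOf g y (F.tangent y) (fun a => e a y)
  basis_normal : ∀ᶠ y in 𝓝 x, IsOrthonormalBasisOf g y (F.normal g y) (fun j => ε j y)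

/-- Gram–Schmidt stays in the span of the given fields at each point, so it does not leave the
distribution; the constant dimension p makes the result a basis nearby. -/
theorem exists_tangent_frame (hg : IsSmoothMetric g) (F : Foliation p n E M) (x : M) :
    ∃ e : Fin (Module.finrank ℝ (F.tangent x)) → ∀ x : M, TangentSpace 𝓘(ℝ, E) x,
      (∀ a, SmoothFieldAt (e a) x) ∧ (∀ a, e a x = tangentBasis g x (F.tangent x) a) ∧
      ∀ᶠ y in 𝓝 x, IsOrthonormalBasisOf g y (F.tangent y) (fun a => e a y) := by
  have hb := tangentBasis_isOrthonormalBasisOf g x (F.tangent x)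
  choose X hX hXx hXt using fun a => exists_smoothFieldAt_tangent (hb.mem a)
  obtain ⟨e, he, hex, heo, hes⟩ := exists_orthonormal_fields hg X hX
    (by simp only [hXx]; exact hb.inner_eq)
  refine ⟨e, he, fun a => by rw [hex, hXx], ?_⟩
  filter_upwards [heo, Filter.eventually_all.2 hXt] with y hy hXy
  refine .of_card (fun a => ?_) hy (by simp [F.finrank_tangent])
  exact Submodule.span_le.2 (by rintro _ ⟨i, rfl⟩; exact hXy i) (hes y a)

/-- Smoothness is invisible in the definition of the projection, whose bases are chosen pointwise; a
smooth tangent frame makes it visible. -/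
theorem SmoothFieldAt.tangentPart (hg : IsSmoothMetric g) {X : ∀ x : M, TangentSpace 𝓘(ℝ, E) x}
    (hX : SmoothFieldAt X x) : SmoothFieldAt (fun y => F.tangentPart g y (X y)) x := by
  obtain ⟨e, he, -, heb⟩ := exists_tangent_frame hg F x
  refine (SmoothFieldAt.sum (s := Finset.univ) fun a =>
    (he a).smul (hg.contMDiffAt (he a) hX)).congr ?_
  filter_upwards [heb] with y hy using tangentPart_eq_sum hy _

theorem DiffFieldAt.tangentPart (hg : IsSmoothMetric g) {X : ∀ x : M, TangentSpace 𝓘(ℝ, E) x}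
    (hX : DiffFieldAt X x) : DiffFieldAt (fun y => F.tangentPart g y (X y)) x := by
  obtain ⟨e, he, -, heb⟩ := exists_tangent_frame hg F x
  refine (DiffFieldAt.sum (s := Finset.univ) fun a =>
    (he a).diffFieldAt.smul (hg.mdifferentiableAt (he a).diffFieldAt hX)).congr ?_
  filter_upwards [heb] with y hy using tangentPart_eq_sum hy _

theorem SmoothFieldAt.normalPart (hg : IsSmoothMetric g) {X : ∀ x : M, TangentSpace 𝓘(ℝ, E) x}
    (hX : SmoothFieldAt X x) : SmoothFieldAt (fun y => F.normalPart g y (X y)) x :=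
  hX.sub (SmoothFieldAt.tangentPart (F := F) hg hX)

theorem DiffFieldAt.normalPart (hg : IsSmoothMetric g) {X : ∀ x : M, TangentSpace 𝓘(ℝ, E) x}
    (hX : DiffFieldAt X x) : DiffFieldAt (fun y => F.normalPart g y (X y)) x :=
  DiffFieldAt.sub hX (DiffFieldAt.tangentPart (F := F) hg hX)

/-- The frame agrees at `x` with the chosen bases, so the sums in the definitions can be read as
sums over frame fields. -/
theorem exists_isAdaptedFrameAt (hg : IsSmoothMetric g) (F : Foliation p n E M) (x : M) :
    ∃ (e : Fin (Module.finrank ℝ (F.tangent x)) → ∀ x : M, TangentSpace 𝓘(ℝ, E) x)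
      (ε : Fin (Module.finrank ℝ (F.normal g x)) → ∀ x : M, TangentSpace 𝓘(ℝ, E) x),
      F.IsAdaptedFrameAt g x e ε ∧ (∀ a, e a x = tangentBasis g x (F.tangent x) a) ∧
      ∀ j, ε j x = tangentBasis g x (F.normal g x) j := by
  obtain ⟨e, he, hex, heb⟩ := exists_tangent_frame hg F x
  have hc := tangentBasis_isOrthonormalBasisOf g x (F.normal g x)
  have hYx : ∀ j, F.normalExtend g (tangentBasis g x (F.normal g x) j) x
      = tangentBasis g x (F.normal g x) j := fun j => by
    rw [normalExtend, FiberBundle.extend_apply_self, normalPart_of_mem_normal (hc.mem j)]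
  obtain ⟨ε, hε, hεx, hεo, hεs⟩ := exists_orthonormal_fields hg
    (fun j => F.normalExtend g (tangentBasis g x (F.normal g x) j))
    (fun j => SmoothFieldAt.normalPart hg (smoothFieldAt_extend _))
    (by simp only [hYx]; exact hc.inner_eq)
  refine ⟨e, ε, ⟨he, hε, heb, ?_⟩, hex, fun j => by rw [hεx, hYx]⟩
  filter_upwards [hεo] with y hy
  refine .of_card (fun j => ?_) hy (by simp [F.finrank_normal])
  exact Submodule.span_le.2 (by rintro _ ⟨i, rfl⟩; exact normalPart_mem _) (hεs y j)

/-- `normalConformal` is only a field of inner products; this gives it the smoothness that the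
connection and curvature lemmas require. -/
theorem isSmoothMetric_normalConformal (hg : IsSmoothMetric g) {u : M → ℝ}
    (hus : ContMDiff 𝓘(ℝ, E) 𝓘(ℝ, ℝ) ∞ u) (hu : ∀ x, 0 < u x) :
    IsSmoothMetric (F.normalConformal g u hu) where
  mdifferentiableAt {X Y x} hX hY := by
    have h := hus.contMDiffAt (x := x) |>.mdifferentiableAt (by simp)
    exact (hg.mdifferentiableAt (DiffFieldAt.tangentPart (F := F) hg hX)
      (DiffFieldAt.tangentPart (F := F) hg hY)).add ((h.pow 2).mul (hg.mdifferentiableAt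
        (DiffFieldAt.normalPart (F := F) hg hX) (DiffFieldAt.normalPart (F := F) hg hY)))
  contMDiffAt {X Y x} hX hY :=
    (hg.contMDiffAt (SmoothFieldAt.tangentPart (F := F) hg hX)
      (SmoothFieldAt.tangentPart (F := F) hg hY)).add ((hus.contMDiffAt.pow 2).mul (hg.contMDiffAt
        (SmoothFieldAt.normalPart (F := F) hg hX) (SmoothFieldAt.normalPart (F := F) hg hY)))

section IsAdaptedFrameAt

variable {ι : Type*} [Fintype ι] [DecidableEq ι] {κ : Type*} [Fintype κ] [DecidableEq κ]
  {e : ι → ∀ x : M, TangentSpace 𝓘(ℝ, E) x} {ε : κ → ∀ x : M, TangentSpace 𝓘(ℝ, E) x}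

theorem IsAdaptedFrameAt.isOrthonormalFrameAt (h : F.IsAdaptedFrameAt g x e ε) :
    IsOrthonormalFrameAt g x (Sum.elim e ε) where
  smooth i := by
    rcases i with a | j
    · exact h.smooth_tangent a
    · exact h.smooth_normal j
  basis := by
    filter_upwards [h.basis_tangent, h.basis_normal] with y h1 h2
    convert isOrthonormalBasisOf_sumElim h1 h2 using 2 with i
    rcases i with a | j <;> rfl

theorem IsAdaptedFrameAt.normalConformal (h : F.IsAdaptedFrameAt g x e ε) {u : M → ℝ}
    (hus : ContMDiff 𝓘(ℝ, E) 𝓘(ℝ, ℝ) ∞ u) (hu : ∀ x, 0 < u x) :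
    F.IsAdaptedFrameAt (F.normalConformal g u hu) x e (fun j y => (u y)⁻¹ • ε j y) where
  smooth_tangent := h.smooth_tangent
  smooth_normal j := (h.smooth_normal j).smul (hus.contMDiffAt.inv₀ (hu x).ne')
  basis_tangent := h.basis_tangent.mono fun _ hy => isOrthonormalBasisOf_tangent_normalConformal hy
  basis_normal := h.basis_normal.mono fun _ hy => isOrthonormalBasisOf_normal_normalConformal hy

end IsAdaptedFrameAt

end Foliation

/-! ### Connection and curvature in terms of structure functions -/

section Coefficients

variable {E : Type*} [NormedAddCommGroup E] [NormedSpace ℝ E]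
  {M : Type*} [TopologicalSpace M] [ChartedSpace E M]

/-- The function `g([X, Y], Z)`. -/
noncomputable def bracketCoeff (g : TangentMetric E M) (X Y Z : ∀ x : M, TangentSpace 𝓘(ℝ, E) x)
    (y : M) : ℝ :=
  g.inner y (mlieBracket 𝓘(ℝ, E) X Y y) (Z y)

variable {g : TangentMetric E M} {x : M} {X Y Z : ∀ x : M, TangentSpace 𝓘(ℝ, E) x}

theorem mvfderiv_sum {ι : Type*} (s : Finset ι) {f : ι → M → ℝ}
    (hf : ∀ i, MDifferentiableAt 𝓘(ℝ, E) 𝓘(ℝ, ℝ) (f i) x) (v : TangentSpace 𝓘(ℝ, E) x) :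
    MDifferentiableAt 𝓘(ℝ, E) 𝓘(ℝ, ℝ) (fun y => ∑ i ∈ s, f i y) x ∧
      mvfderiv 𝓘(ℝ, E) (fun y => ∑ i ∈ s, f i y) x v = ∑ i ∈ s, mvfderiv 𝓘(ℝ, E) (f i) x v := by
  classical
  induction s using Finset.induction_on with
  | empty =>
    simp only [Finset.sum_empty]
    exact ⟨mdifferentiableAt_const, by rw [mvfderiv_const, zero_apply]⟩
  | insert i s hi ih =>
    simp only [Finset.sum_insert hi]
    refine ⟨(hf i).add ih.1, ?_⟩
    have h := mvfderiv_add (hf i) ih.1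
    rw [← ih.2]
    exact congrArg (fun L => L v) h

theorem bracketCoeff_swap : bracketCoeff g X Y Z x = - bracketCoeff g Y X Z x := by
  rw [bracketCoeff, bracketCoeff, mlieBracket_swap_apply, map_neg, neg_apply]

variable [IsManifold 𝓘(ℝ, E) ∞ M]

/-- The function `g(∇_X Y, Z)`. -/
noncomputable def connCoeff (g : TangentMetric E M) (X Y Z : ∀ x : M, TangentSpace 𝓘(ℝ, E) x)
    (y : M) : ℝ :=
  g.inner y (leviCivita g y (X y) Y) (Z y)

variable [FiniteDimensional ℝ E]

theorem bracketCoeff_eq (hg : IsSmoothMetric g) (hX : DiffFieldAt X x) (hY : DiffFieldAt Y x) :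
    bracketCoeff g X Y Z x = connCoeff g X Y Z x - connCoeff g Y X Z x := by
  rw [bracketCoeff, connCoeff, connCoeff, ← leviCivita_sub_leviCivita hg hX hY, map_sub, sub_apply]

theorem inner_leviCivita_of_const (hg : IsSmoothMetric g) (hY : DiffFieldAt Y x)
    (hZ : DiffFieldAt Z x) {c : ℝ} (h : ∀ᶠ y in 𝓝 x, g.inner y (Y y) (Z y) = c)
    (v : TangentSpace 𝓘(ℝ, E) x) :
    g.inner x (leviCivita g x v Y) (Z x) = - g.inner x (leviCivita g x v Z) (Y x) := by
  have h1 := mvfderiv_inner hg hY hZ v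
  have h2 : (fun y => g.inner y (Y y) (Z y)) =ᶠ[𝓝 x] fun _ => c := h
  rw [mvfderiv_congr_of_eventuallyEq h2, mvfderiv_const, zero_apply, g.symm x (Y x)] at h1
  linarith

/-- Koszul's formula without the derivatives of inner products: torsion-freeness expresses the
brackets by the connection, and constancy of the inner products makes it skew in its last two
arguments. -/
theorem two_mul_connCoeff (hg : IsSmoothMetric g) (hX : DiffFieldAt X x) (hY : DiffFieldAt Y x)
    (hZ : DiffFieldAt Z x) {c c' c'' : ℝ} (hXY : ∀ᶠ y in 𝓝 x, g.inner y (X y) (Y y) = c)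
    (hYZ : ∀ᶠ y in 𝓝 x, g.inner y (Y y) (Z y) = c')
    (hXZ : ∀ᶠ y in 𝓝 x, g.inner y (X y) (Z y) = c'') :
    2 * connCoeff g X Y Z x
      = bracketCoeff g X Y Z x - bracketCoeff g X Z Y x - bracketCoeff g Y Z X x := by
  rw [bracketCoeff_eq hg hX hY, bracketCoeff_eq hg hX hZ, bracketCoeff_eq hg hY hZ]
  have h1 := inner_leviCivita_of_const hg hY hZ hYZ (X x)
  have h2 := inner_leviCivita_of_const hg hX hY hXY (Z x)
  have h3 := inner_leviCivita_of_const hg hX hZ hXZ (Y x)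
  simp only [connCoeff]
  linarith

theorem IsOrthonormalFrameAt.two_mul_connCoeff (hg : IsSmoothMetric g) {ι : Type*} [Fintype ι]
    [DecidableEq ι] {e : ι → ∀ x : M, TangentSpace 𝓘(ℝ, E) x} (he : IsOrthonormalFrameAt g x e) :
    ∀ᶠ y in 𝓝 x, ∀ i j k, 2 * connCoeff g (e i) (e j) (e k) y
      = bracketCoeff g (e i) (e j) (e k) y - bracketCoeff g (e i) (e k) (e j) y
        - bracketCoeff g (e j) (e k) (e i) y := by
  have h1 : ∀ᶠ y in 𝓝 x, ∀ i, DiffFieldAt (e i) y :=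
    Filter.eventually_all.2 fun i => (he.smooth i).eventually_diffFieldAt
  filter_upwards [h1, he.basis.eventually_nhds] with y hy hb i j k
  exact _root_.two_mul_connCoeff hg (hy i) (hy j) (hy k) (hb.mono fun z hz => hz.inner_eq i j)
    (hb.mono fun z hz => hz.inner_eq j k) (hb.mono fun z hz => hz.inner_eq i k)

/-- The sectional curvature of two smooth fields in terms of the Levi-Civita connection. -/
theorem sectionalCurvature_eq_connCoeff (hg : IsSmoothMetric g) (hX : SmoothFieldAt X x)
    (hY : SmoothFieldAt Y x) :
    sectionalCurvature g x (X x) (Y x)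
      = mvfderiv 𝓘(ℝ, E) (connCoeff g X X Y) x (Y x) - mvfderiv 𝓘(ℝ, E) (connCoeff g Y X Y) x (X x)
        - g.inner x (leviCivita g x (X x) X) (leviCivita g x (Y x) Y)
        + g.inner x (leviCivita g x (Y x) X) (leviCivita g x (X x) Y)
        + g.inner x (leviCivita g x (mlieBracket 𝓘(ℝ, E) X Y x) X) (Y x) := by
  have h1 := mvfderiv_inner hg (hX.leviCivita hg hX).diffFieldAt hY.diffFieldAt (Y x)
  have h2 := mvfderiv_inner hg (hY.leviCivita hg hX).diffFieldAt hY.diffFieldAt (X x)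
  rw [sectionalCurvature_eq hg hX hY]
  unfold connCoeff
  simp only [curvature, map_add, map_sub, add_apply, sub_apply]
  linarith

/-- The products of covariant derivatives are expanded by Parseval, and the derivative along [e_i,
e_a] by linearity in its direction. -/
theorem IsOrthonormalFrameAt.sectionalCurvature_eq (hg : IsSmoothMetric g) {ι : Type*} [Fintype ι]
    [DecidableEq ι] {e : ι → ∀ x : M, TangentSpace 𝓘(ℝ, E) x} (he : IsOrthonormalFrameAt g x e)
    (i a : ι) :
    sectionalCurvature g x (e i x) (e a x)
      = mvfderiv 𝓘(ℝ, E) (connCoeff g (e i) (e i) (e a)) x (e a x)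
        - mvfderiv 𝓘(ℝ, E) (connCoeff g (e a) (e i) (e a)) x (e i x)
        - ∑ k, connCoeff g (e i) (e i) (e k) x * connCoeff g (e a) (e a) (e k) x
        + ∑ k, connCoeff g (e a) (e i) (e k) x * connCoeff g (e i) (e a) (e k) x
        + ∑ k, bracketCoeff g (e i) (e a) (e k) x * connCoeff g (e k) (e i) (e a) x := by
  have hb := he.basis.self_of_nhds
  have hin : ∀ v w : TangentSpace 𝓘(ℝ, E) x,
      g.inner x v w = ∑ k, g.inner x v (e k x) * g.inner x w (e k x) := by
    intro v w
    rw [hb.inner_eq_sum (v := v) trivial]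
    exact Finset.sum_congr rfl fun k _ => by rw [g.symm x v, g.symm x w]
  have hbr : g.inner x (leviCivita g x (mlieBracket 𝓘(ℝ, E) (e i) (e a) x) (e i)) (e a x)
      = ∑ k, bracketCoeff g (e i) (e a) (e k) x * connCoeff g (e k) (e i) (e a) x := by
    conv_lhs => rw [← hb.sum_eq (mlieBracket 𝓘(ℝ, E) (e i) (e a) x) trivial]
    rw [leviCivita_sum_left hg (he.smooth i).diffFieldAt]
    simp only [map_sum, map_smul, sum_apply, smul_apply, smul_eq_mul, bracketCoeff, connCoeff]
    exact Finset.sum_congr rfl fun k _ => by rw [g.symm x (e k x)]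
  rw [sectionalCurvature_eq_connCoeff hg (he.smooth i) (he.smooth a), hbr, hin, hin]
  simp only [connCoeff]

theorem sum_sum_eq_zero_of_antisymm {ι : Type*} [Fintype ι] {f : ι → ι → ℝ}
    (h : ∀ i j, f i j = - f j i) : ∑ i, ∑ j, f i j = 0 := by
  have h1 : ∑ i, ∑ j, f i j = - ∑ i, ∑ j, f i j := by
    conv_lhs => rw [Finset.sum_comm]
    rw [← Finset.sum_neg_distrib]
    refine Finset.sum_congr rfl fun i _ => ?_
    rw [← Finset.sum_neg_distrib]
    exact Finset.sum_congr rfl fun j _ => h j i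
  linarith

end Coefficients

/-! ### The mixed scalar curvature in an adapted frame -/

namespace Foliation

variable {p n : ℕ} {E : Type*} [NormedAddCommGroup E] [NormedSpace ℝ E] [FiniteDimensional ℝ E]
  {M : Type*} [TopologicalSpace M] [ChartedSpace E M] [IsManifold 𝓘(ℝ, E) ∞ M]
  {F : Foliation p n E M} {x : M} {g : TangentMetric E M}
  {ι : Type*} [Fintype ι] [DecidableEq ι] {κ : Type*} [Fintype κ] [DecidableEq κ]
  {e : ι → ∀ x : M, TangentSpace 𝓘(ℝ, E) x} {ε : κ → ∀ x : M, TangentSpace 𝓘(ℝ, E) x}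

theorem IsAdaptedFrameAt.bracketCoeff_eq_zero (h : F.IsAdaptedFrameAt g x e ε) (a b : ι) (j : κ) :
    bracketCoeff g (e a) (e b) (ε j) x = 0 := by
  have hc := h.basis_normal.self_of_nhds
  rw [bracketCoeff, g.symm]
  exact inner_normal_tangent (hc.mem j) (mlieBracket_mem_tangent (h.smooth_tangent a)
    (h.smooth_tangent b) (h.basis_tangent.mono fun y hy => hy.mem a)
    (h.basis_tangent.mono fun y hy => hy.mem b))

/-- Needed on a neighbourhood and not only at `x`, since these two coefficients are differentiated
in the curvature. -/
theorem IsAdaptedFrameAt.eventually_connCoeff (hg : IsSmoothMetric g)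
    (h : F.IsAdaptedFrameAt g x e ε) :
    ∀ᶠ y in 𝓝 x, (∀ a j, connCoeff g (ε j) (ε j) (e a) y = bracketCoeff g (e a) (ε j) (ε j) y) ∧
      ∀ a j, connCoeff g (e a) (ε j) (e a) y = bracketCoeff g (e a) (ε j) (e a) y := by
  filter_upwards [h.isOrthonormalFrameAt.two_mul_connCoeff hg] with y hy
  constructor
  · intro a j
    have h1 := hy (.inr j) (.inr j) (.inl a)
    simp only [Sum.elim_inl, Sum.elim_inr] at h1
    rw [bracketCoeff_swap (X := ε j) (Y := e a), bracketCoeff_swap (X := ε j) (Y := ε j)] at h1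
    have h2 := bracketCoeff_swap (g := g) (X := ε j) (Y := ε j) (Z := e a) (x := y)
    linarith
  · intro a j
    have h1 := hy (.inl a) (.inr j) (.inl a)
    simp only [Sum.elim_inl, Sum.elim_inr] at h1
    rw [bracketCoeff_swap (X := ε j) (Y := e a)] at h1
    have h2 := bracketCoeff_swap (g := g) (X := e a) (Y := e a) (Z := ε j) (x := y)
    linarith

/-- The mixed scalar curvature of a foliation with minimal leaves, in terms of the structure
functions of an adapted frame. -/
theorem IsAdaptedFrameAt.mixedScalarCurvature_eq (hg : IsSmoothMetric g)
    (h : F.IsAdaptedFrameAt g x e ε)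
    (hmin : ∀ᶠ y in 𝓝 x, ∀ j, ∑ a, bracketCoeff g (e a) (ε j) (e a) y = 0) :
    F.mixedScalarCurvature g x
      = ∑ a, ∑ j, mvfderiv 𝓘(ℝ, E) (bracketCoeff g (e a) (ε j) (ε j)) x (e a x)
        - ∑ a, ∑ b, (∑ j, bracketCoeff g (e b) (ε j) (ε j) x) * bracketCoeff g (e b) (e a) (e a) x
        - (∑ j, ∑ a, ∑ b,
            (bracketCoeff g (e a) (ε j) (e b) x + bracketCoeff g (e b) (ε j) (e a) x) ^ 2) / 4
        - (∑ a, ∑ i, ∑ j,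
            (bracketCoeff g (e a) (ε i) (ε j) x + bracketCoeff g (e a) (ε j) (ε i) x) ^ 2) / 4
        + (∑ a, ∑ i, ∑ j, bracketCoeff g (ε i) (ε j) (e a) x ^ 2) / 4 := by
  have hf := h.isOrthonormalFrameAt
  have hev := h.eventually_connCoeff hg
  have hG := (hf.two_mul_connCoeff hg).self_of_nhds
  have hK := hf.sectionalCurvature_eq hg
  rw [mixedScalarCurvature, sum_sectionalCurvature_eq hg
    (tangentBasis_isOrthonormalBasisOf g x (F.normal g x)) h.basis_normal.self_of_nhds
    (tangentBasis_isOrthonormalBasisOf g x (F.tangent x)) h.basis_tangent.self_of_nhds]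
  -- Each summand is split into squares that survive the summation, terms that minimality removes,
  -- and remainders antisymmetric in (a, b) or in (i, j).
  have hP : ∀ j a, sectionalCurvature g x (ε j x) (e a x)
      = mvfderiv 𝓘(ℝ, E) (bracketCoeff g (e a) (ε j) (ε j)) x (e a x)
        - mvfderiv 𝓘(ℝ, E) (connCoeff g (e a) (ε j) (e a)) x (ε j x)
        - ∑ b, bracketCoeff g (e b) (ε j) (ε j) x * bracketCoeff g (e b) (e a) (e a) x
        + ∑ i, connCoeff g (ε j) (ε j) (ε i) x * bracketCoeff g (e a) (ε i) (e a) x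
        + ∑ b, (-((bracketCoeff g (e a) (ε j) (e b) x + bracketCoeff g (e b) (ε j) (e a) x) ^ 2 / 4)
          + (bracketCoeff g (e b) (ε j) (e a) x ^ 2 - bracketCoeff g (e a) (ε j) (e b) x ^ 2) / 2)
        + ∑ i, (-((bracketCoeff g (e a) (ε j) (ε i) x + bracketCoeff g (e a) (ε i) (ε j) x) ^ 2 / 4)
          + bracketCoeff g (ε j) (ε i) (e a) x ^ 2 / 4
          + ((bracketCoeff g (e a) (ε i) (ε j) x ^ 2 - bracketCoeff g (e a) (ε j) (ε i) x ^ 2) / 2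
            + (bracketCoeff g (e a) (ε j) (ε i) x + bracketCoeff g (e a) (ε i) (ε j) x)
              * bracketCoeff g (ε j) (ε i) (e a) x / 2)) := by
    intro j a
    have h1 := hK (.inr j) (.inl a)
    simp only [Sum.elim_inl, Sum.elim_inr, Fintype.sum_sum_type] at h1
    rw [h1, mvfderiv_congr_of_eventuallyEq (hev.mono fun y hy => hy.1 a j)]
    have hab : ∀ b, bracketCoeff g (e a) (e b) (ε j) x = 0 := fun b => h.bracketCoeff_eq_zero a b j
    have hja : ∀ Z, bracketCoeff g (ε j) (e a) Z x = - bracketCoeff g (e a) (ε j) Z x :=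
      fun Z => bracketCoeff_swap
    have s1 : ∀ b, connCoeff g (ε j) (ε j) (e b) x * connCoeff g (e a) (e a) (e b) x
        = bracketCoeff g (e b) (ε j) (ε j) x * bracketCoeff g (e b) (e a) (e a) x := by
      intro b
      have h2 := hG (.inl a) (.inl a) (.inl b)
      simp only [Sum.elim_inl] at h2
      rw [bracketCoeff_swap (X := e a) (Y := e b)] at h2
      have h3 := bracketCoeff_swap (g := g) (X := e a) (Y := e a) (Z := e b) (x := x)
      rw [hev.self_of_nhds.1 b j, show connCoeff g (e a) (e a) (e b) x
        = bracketCoeff g (e b) (e a) (e a) x by linarith]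
    have s2 : ∀ i, connCoeff g (ε j) (ε j) (ε i) x * connCoeff g (e a) (e a) (ε i) x
        = - (connCoeff g (ε j) (ε j) (ε i) x * bracketCoeff g (e a) (ε i) (e a) x) := by
      intro i
      have h2 := hG (.inl a) (.inl a) (.inr i)
      simp only [Sum.elim_inl, Sum.elim_inr] at h2
      have h3 := bracketCoeff_swap (g := g) (X := e a) (Y := e a) (Z := ε i) (x := x)
      rw [show connCoeff g (e a) (e a) (ε i) x = - bracketCoeff g (e a) (ε i) (e a) x by linarith]
      ring
    -- Products of connection coefficients are paired with the terms of the derivative along [ε_j,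
    -- e_a]. Tangential directions give ‖h‖² by involutivity; the normal ones, in `s4`, give ‖h^⊥‖²
    -- and ‖T‖².
    have s3 : ∀ b, connCoeff g (e a) (ε j) (e b) x * connCoeff g (ε j) (e a) (e b) x
          + bracketCoeff g (ε j) (e a) (e b) x * connCoeff g (e b) (ε j) (e a) x
        = -((bracketCoeff g (e a) (ε j) (e b) x + bracketCoeff g (e b) (ε j) (e a) x) ^ 2 / 4)
          + (bracketCoeff g (e b) (ε j) (e a) x ^ 2 - bracketCoeff g (e a) (ε j) (e b) x ^ 2) / 2 := by
      intro b
      have h2 := hG (.inl a) (.inr j) (.inl b)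
      have h3 := hG (.inr j) (.inl a) (.inl b)
      have h4 := hG (.inl b) (.inr j) (.inl a)
      simp only [Sum.elim_inl, Sum.elim_inr] at h2 h3 h4
      rw [bracketCoeff_swap (X := ε j) (Y := e b), hab] at h2
      rw [bracketCoeff_swap (X := ε j) (Y := e b), hab, hja] at h3
      rw [hja, bracketCoeff_swap (X := e b) (Y := e a), hab] at h4
      rw [hja, show connCoeff g (e a) (ε j) (e b) x = (bracketCoeff g (e a) (ε j) (e b) x
          + bracketCoeff g (e b) (ε j) (e a) x) / 2 by linarith,
        show connCoeff g (ε j) (e a) (e b) x = (bracketCoeff g (e b) (ε j) (e a) x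
          - bracketCoeff g (e a) (ε j) (e b) x) / 2 by linarith,
        show connCoeff g (e b) (ε j) (e a) x = (bracketCoeff g (e a) (ε j) (e b) x
          + bracketCoeff g (e b) (ε j) (e a) x) / 2 by linarith]
      ring
    have s4 : ∀ i, connCoeff g (e a) (ε j) (ε i) x * connCoeff g (ε j) (e a) (ε i) x
          + bracketCoeff g (ε j) (e a) (ε i) x * connCoeff g (ε i) (ε j) (e a) x
        = -((bracketCoeff g (e a) (ε j) (ε i) x + bracketCoeff g (e a) (ε i) (ε j) x) ^ 2 / 4)
          + bracketCoeff g (ε j) (ε i) (e a) x ^ 2 / 4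
          + ((bracketCoeff g (e a) (ε i) (ε j) x ^ 2 - bracketCoeff g (e a) (ε j) (ε i) x ^ 2) / 2
            + (bracketCoeff g (e a) (ε j) (ε i) x + bracketCoeff g (e a) (ε i) (ε j) x)
              * bracketCoeff g (ε j) (ε i) (e a) x / 2) := by
      intro i
      have h2 := hG (.inl a) (.inr j) (.inr i)
      have h3 := hG (.inr j) (.inl a) (.inr i)
      have h4 := hG (.inr i) (.inr j) (.inl a)
      simp only [Sum.elim_inl, Sum.elim_inr] at h2 h3 h4
      rw [hja] at h3
      rw [bracketCoeff_swap (X := ε i) (Y := ε j), bracketCoeff_swap (X := ε i) (Y := e a),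
        hja] at h4
      rw [hja, show connCoeff g (e a) (ε j) (ε i) x = (bracketCoeff g (e a) (ε j) (ε i) x
          - bracketCoeff g (e a) (ε i) (ε j) x - bracketCoeff g (ε j) (ε i) (e a) x) / 2 by linarith,
        show connCoeff g (ε j) (e a) (ε i) x = (- bracketCoeff g (e a) (ε j) (ε i) x
          - bracketCoeff g (ε j) (ε i) (e a) x - bracketCoeff g (e a) (ε i) (ε j) x) / 2 by linarith,
        show connCoeff g (ε i) (ε j) (e a) x = (- bracketCoeff g (ε j) (ε i) (e a) x
          + bracketCoeff g (e a) (ε i) (ε j) x + bracketCoeff g (e a) (ε j) (ε i) x) / 2 by linarith]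
      ring
    rw [← Finset.sum_congr rfl fun b _ => s3 b, ← Finset.sum_congr rfl fun i _ => s4 i,
      Finset.sum_congr rfl fun b _ => s1 b, Finset.sum_congr rfl fun i _ => s2 i,
      Finset.sum_add_distrib, Finset.sum_add_distrib, Finset.sum_neg_distrib]
    ring
  have hdiff : ∀ a j, MDifferentiableAt 𝓘(ℝ, E) 𝓘(ℝ, ℝ) (connCoeff g (e a) (ε j) (e a)) x :=
    fun a j => hg.mdifferentiableAt
      ((h.smooth_tangent a).leviCivita hg (h.smooth_normal j)).diffFieldAt
      (h.smooth_tangent a).diffFieldAt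
  -- The trace vanishes identically near `x`, so its derivative in the normal direction vanishes
  -- too.
  have t1 : ∀ j, ∑ a, mvfderiv 𝓘(ℝ, E) (connCoeff g (e a) (ε j) (e a)) x (ε j x) = 0 := by
    intro j
    have h1 : (fun y => ∑ a, connCoeff g (e a) (ε j) (e a) y) =ᶠ[𝓝 x] fun _ => (0 : ℝ) := by
      filter_upwards [hev, hmin] with y hy hm
      rw [← hm j]
      exact Finset.sum_congr rfl fun a _ => hy.2 a j
    rw [← (mvfderiv_sum Finset.univ (fun a => hdiff a j) _).2, mvfderiv_congr_of_eventuallyEq h1,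
      mvfderiv_const, zero_apply]
  have t2 : ∀ j, ∑ a, ∑ i, connCoeff g (ε j) (ε j) (ε i) x * bracketCoeff g (e a) (ε i) (e a) x
      = 0 := by
    intro j
    rw [Finset.sum_comm]
    refine Finset.sum_eq_zero fun i _ => ?_
    rw [← Finset.mul_sum, hmin.self_of_nhds i, mul_zero]
  have t3 : ∀ j, ∑ a, ∑ b, (bracketCoeff g (e b) (ε j) (e a) x ^ 2
      - bracketCoeff g (e a) (ε j) (e b) x ^ 2) / 2 = 0 :=
    fun j => sum_sum_eq_zero_of_antisymm fun a b => by ring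
  have t4 : ∀ a, ∑ j, ∑ i, ((bracketCoeff g (e a) (ε i) (ε j) x ^ 2
      - bracketCoeff g (e a) (ε j) (ε i) x ^ 2) / 2
      + (bracketCoeff g (e a) (ε j) (ε i) x + bracketCoeff g (e a) (ε i) (ε j) x)
        * bracketCoeff g (ε j) (ε i) (e a) x / 2) = 0 := by
    refine fun a => sum_sum_eq_zero_of_antisymm fun j i => ?_
    rw [bracketCoeff_swap (X := ε i) (Y := ε j)]
    ring
  have tP : ∀ j, ∑ a, ∑ b, (-((bracketCoeff g (e a) (ε j) (e b) x
        + bracketCoeff g (e b) (ε j) (e a) x) ^ 2 / 4)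
      + (bracketCoeff g (e b) (ε j) (e a) x ^ 2 - bracketCoeff g (e a) (ε j) (e b) x ^ 2) / 2)
      = -((∑ a, ∑ b, (bracketCoeff g (e a) (ε j) (e b) x
        + bracketCoeff g (e b) (ε j) (e a) x) ^ 2) / 4) := by
    intro j
    rw [Finset.sum_congr rfl fun a _ => Finset.sum_add_distrib, Finset.sum_add_distrib, t3, add_zero]
    simp only [Finset.sum_neg_distrib, Finset.sum_div]
  have tQ : ∀ a, ∑ j, ∑ i, (-((bracketCoeff g (e a) (ε j) (ε i) x
        + bracketCoeff g (e a) (ε i) (ε j) x) ^ 2 / 4)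
      + bracketCoeff g (ε j) (ε i) (e a) x ^ 2 / 4
      + ((bracketCoeff g (e a) (ε i) (ε j) x ^ 2 - bracketCoeff g (e a) (ε j) (ε i) x ^ 2) / 2
        + (bracketCoeff g (e a) (ε j) (ε i) x + bracketCoeff g (e a) (ε i) (ε j) x)
          * bracketCoeff g (ε j) (ε i) (e a) x / 2))
      = -((∑ j, ∑ i, (bracketCoeff g (e a) (ε j) (ε i) x
        + bracketCoeff g (e a) (ε i) (ε j) x) ^ 2) / 4)
        + (∑ j, ∑ i, bracketCoeff g (ε j) (ε i) (e a) x ^ 2) / 4 := by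
    intro a
    rw [Finset.sum_congr rfl fun j _ => Finset.sum_add_distrib, Finset.sum_add_distrib, t4, add_zero,
      Finset.sum_congr rfl fun j _ => Finset.sum_add_distrib, Finset.sum_add_distrib]
    simp only [Finset.sum_neg_distrib, Finset.sum_div]
  have key : ∀ A B C D P Q : κ → ι → ℝ, ∑ j, ∑ a, (A j a - B j a - C j a + D j a + P j a + Q j a)
      = ∑ a, ∑ j, A j a - ∑ j, ∑ a, B j a - ∑ a, ∑ j, C j a + ∑ j, ∑ a, D j a
        + ∑ j, ∑ a, P j a + ∑ a, ∑ j, Q j a := by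
    intro A B C D P Q
    rw [Finset.sum_comm (f := fun a j => A j a), Finset.sum_comm (f := fun a j => C j a),
      Finset.sum_comm (f := fun a j => Q j a)]
    simp only [Finset.sum_add_distrib, Finset.sum_sub_distrib]
  have tC : ∀ a, ∑ j, ∑ b, bracketCoeff g (e b) (ε j) (ε j) x * bracketCoeff g (e b) (e a) (e a) x
      = ∑ b, (∑ j, bracketCoeff g (e b) (ε j) (ε j) x) * bracketCoeff g (e b) (e a) (e a) x := by
    intro a
    rw [Finset.sum_comm]
    simp only [Finset.sum_mul]
  rw [Finset.sum_congr rfl fun j _ => Finset.sum_congr rfl fun a _ => hP j a, key]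
  simp only [t1, t2, tP, tQ, tC, Finset.sum_const_zero]
  rw [Finset.sum_add_distrib]
  simp only [Finset.sum_neg_distrib, ← Finset.sum_div]
  ring

end Foliation

/-! ### The extrinsic quantities in an adapted frame -/

namespace Foliation

variable {p n : ℕ} {E : Type*} [NormedAddCommGroup E] [NormedSpace ℝ E] [FiniteDimensional ℝ E]
  {M : Type*} [TopologicalSpace M] [ChartedSpace E M] [IsManifold 𝓘(ℝ, E) ∞ M]
  {F : Foliation p n E M} {x : M} {g : TangentMetric E M}

theorem tangentExtend_self {v : TangentSpace 𝓘(ℝ, E) x} (hv : v ∈ F.tangent x) :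
    F.tangentExtend g v x = v := by
  rw [tangentExtend, FiberBundle.extend_apply_self, tangentPart_of_mem hv]

theorem normalExtend_self {v : TangentSpace 𝓘(ℝ, E) x} (hv : v ∈ F.normal g x) :
    F.normalExtend g v x = v := by
  rw [normalExtend, FiberBundle.extend_apply_self, normalPart_of_mem_normal hv]

theorem diffFieldAt_tangentExtend (hg : IsSmoothMetric g) (v : TangentSpace 𝓘(ℝ, E) x) :
    DiffFieldAt (F.tangentExtend g v) x :=
  DiffFieldAt.tangentPart hg (smoothFieldAt_extend v).diffFieldAt

theorem diffFieldAt_normalExtend (hg : IsSmoothMetric g) (v : TangentSpace 𝓘(ℝ, E) x) :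
    DiffFieldAt (F.normalExtend g v) x :=
  DiffFieldAt.normalPart hg (smoothFieldAt_extend v).diffFieldAt

theorem secondFundamentalForm_mem_normal (v w : TangentSpace 𝓘(ℝ, E) x) :
    F.secondFundamentalForm g x v w ∈ F.normal g x :=
  normalPart_mem _

theorem integrabilityTensor_mem_tangent (v w : TangentSpace 𝓘(ℝ, E) x) :
    F.integrabilityTensor g x v w ∈ F.tangent x :=
  Submodule.smul_mem _ _ (tangentPart_mem _)

theorem normalMeanCurvature_mem_tangent : F.normalMeanCurvature g x ∈ F.tangent x :=
  Submodule.sum_mem _ fun _ _ => Submodule.smul_mem _ _ (tangentPart_mem _)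

section

variable {X V W : ∀ x : M, TangentSpace 𝓘(ℝ, E) x}

/-- Moving the covariant derivative between a normal and a tangent field. -/
theorem inner_leviCivita_normal (hg : IsSmoothMetric g) (hX : DiffFieldAt X x)
    (hXt : ∀ᶠ y in 𝓝 x, X y ∈ F.tangent y) (hV : DiffFieldAt V x)
    (hVn : ∀ᶠ y in 𝓝 x, V y ∈ F.normal g y) (v : TangentSpace 𝓘(ℝ, E) x) :
    g.inner x (leviCivita g x v V) (X x) = - g.inner x (leviCivita g x v X) (V x) := by
  refine inner_leviCivita_of_const hg hV hX (c := 0) ?_ v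
  filter_upwards [hXt, hVn] with y h1 h2 using inner_normal_tangent h2 h1

/-- The right-hand side involves V and W only through their values at `x`, so frame fields may
replace the extensions in `integrabilityTensor`. -/
theorem inner_mlieBracket_normal (hg : IsSmoothMetric g) (hX : DiffFieldAt X x)
    (hXt : ∀ᶠ y in 𝓝 x, X y ∈ F.tangent y) (hV : DiffFieldAt V x)
    (hVn : ∀ᶠ y in 𝓝 x, V y ∈ F.normal g y) (hW : DiffFieldAt W x)
    (hWn : ∀ᶠ y in 𝓝 x, W y ∈ F.normal g y) :
    g.inner x (mlieBracket 𝓘(ℝ, E) V W x) (X x)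
      = g.inner x (leviCivita g x (W x) X) (V x) - g.inner x (leviCivita g x (V x) X) (W x) := by
  rw [← leviCivita_sub_leviCivita hg hV hW, map_sub, sub_apply,
    inner_leviCivita_normal hg hX hXt hV hVn, inner_leviCivita_normal hg hX hXt hW hWn]
  ring

/-- Differentiating the normal field instead removes the tangential extension and shows bilinearity
in `v` and `w`. -/
theorem inner_secondFundamentalForm (hg : IsSmoothMetric g) (hV : DiffFieldAt V x)
    (hVn : ∀ᶠ y in 𝓝 x, V y ∈ F.normal g y) (v : TangentSpace 𝓘(ℝ, E) x)
    {w : TangentSpace 𝓘(ℝ, E) x} (hw : w ∈ F.tangent x) :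
    g.inner x (V x) (F.secondFundamentalForm g x v w) = - g.inner x (leviCivita g x v V) w := by
  have h := inner_leviCivita_normal (F := F) hg (diffFieldAt_tangentExtend hg w)
    (.of_forall fun y => tangentPart_mem _) hV hVn v
  rw [tangentExtend_self hw] at h
  rw [secondFundamentalForm, inner_normalPart hVn.self_of_nhds, h, g.symm, neg_neg]

/-- Up to sign the sum is g(V, H), written as a trace and so available in any orthonormal basis. -/
theorem sum_inner_leviCivita_of_isHarmonic (hg : IsSmoothMetric g) (hF : F.IsHarmonic g)
    (hV : DiffFieldAt V x) (hVn : ∀ᶠ y in 𝓝 x, V y ∈ F.normal g y) {ι : Type*} [Fintype ι]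
    [DecidableEq ι] {b : ι → TangentSpace 𝓘(ℝ, E) x}
    (hb : IsOrthonormalBasisOf g x (F.tangent x) b) :
    ∑ a, g.inner x (leviCivita g x (b a) V) (b a) = 0 := by
  have ht := tangentBasis_isOrthonormalBasisOf g x (F.tangent x)
  have h1 := hb.trace_eq ht (LinearMap.mk₂ ℝ (fun v w => g.inner x (leviCivita g x v V) w)
    (fun v v' w => by rw [leviCivita_add_left hg hV, map_add, add_apply])
    (fun c v w => by rw [leviCivita_smul_left hg hV, map_smul, smul_apply])
    (fun v w w' => map_add _ _ _) (fun c v w => map_smul _ _ _))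
  simp only [LinearMap.mk₂_apply] at h1
  have h2 : g.inner x (V x) (F.meanCurvature g x) = 0 := by rw [hF x, map_zero]
  rw [meanCurvature, map_sum,
    Finset.sum_congr rfl fun a _ => inner_secondFundamentalForm hg hV hVn _ (ht.mem a),
    Finset.sum_neg_distrib, neg_eq_zero] at h2
  exact h1.trans h2

end

section

variable {ι : Type*} [Fintype ι] [DecidableEq ι] {κ : Type*} [Fintype κ] [DecidableEq κ]
  {e : ι → ∀ x : M, TangentSpace 𝓘(ℝ, E) x} {ε : κ → ∀ x : M, TangentSpace 𝓘(ℝ, E) x}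

theorem IsAdaptedFrameAt.sum_bracketCoeff_of_isHarmonic (hg : IsSmoothMetric g)
    (hF : F.IsHarmonic g) (h : F.IsAdaptedFrameAt g x e ε) :
    ∀ᶠ y in 𝓝 x, ∀ j, ∑ a, bracketCoeff g (e a) (ε j) (e a) y = 0 := by
  have h1 : ∀ᶠ y in 𝓝 x, ∀ j, DiffFieldAt (ε j) y :=
    Filter.eventually_all.2 fun j => (h.smooth_normal j).eventually_diffFieldAt
  filter_upwards [h.eventually_connCoeff hg, h1, h.basis_tangent, h.basis_normal.eventually_nhds]
    with y hy hd hb hn j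
  rw [← sum_inner_leviCivita_of_isHarmonic hg hF (hd j) (hn.mono fun z hz => hz.mem j) hb]
  exact Finset.sum_congr rfl fun a _ => (hy.2 a j).symm

theorem IsAdaptedFrameAt.connCoeff_tangent_normal_tangent (hg : IsSmoothMetric g)
    (h : F.IsAdaptedFrameAt g x e ε) (a b : ι) (j : κ) :
    connCoeff g (e a) (ε j) (e b) x
      = (bracketCoeff g (e a) (ε j) (e b) x + bracketCoeff g (e b) (ε j) (e a) x) / 2 := by
  have h1 := (h.isOrthonormalFrameAt.two_mul_connCoeff hg).self_of_nhds (.inl a) (.inr j) (.inl b)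
  simp only [Sum.elim_inl, Sum.elim_inr] at h1
  rw [bracketCoeff_swap (X := ε j) (Y := e b), h.bracketCoeff_eq_zero] at h1
  linarith

end

section

variable {e : Fin (Module.finrank ℝ (F.tangent x)) → ∀ x : M, TangentSpace 𝓘(ℝ, E) x}
  {ε : Fin (Module.finrank ℝ (F.normal g x)) → ∀ x : M, TangentSpace 𝓘(ℝ, E) x}

theorem IsAdaptedFrameAt.secondFundamentalFormNormSq_eq (hg : IsSmoothMetric g)
    (h : F.IsAdaptedFrameAt g x e ε) (he : ∀ a, e a x = tangentBasis g x (F.tangent x) a) :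
    F.secondFundamentalFormNormSq g x = (∑ j, ∑ a, ∑ b,
      (bracketCoeff g (e a) (ε j) (e b) x + bracketCoeff g (e b) (ε j) (e a) x) ^ 2) / 4 := by
  have hb := h.basis_tangent.self_of_nhds
  have hc := h.basis_normal.self_of_nhds
  have h1 : ∀ a b j, g.inner x (ε j x) (F.secondFundamentalForm g x (e a x) (e b x))
      = - ((bracketCoeff g (e a) (ε j) (e b) x + bracketCoeff g (e b) (ε j) (e a) x) / 2) := by
    intro a b j
    rw [inner_secondFundamentalForm hg (h.smooth_normal j).diffFieldAt
      (h.basis_normal.mono fun y hy => hy.mem j) _ (hb.mem b),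
      ← h.connCoeff_tangent_normal_tangent hg, connCoeff]
  simp only [secondFundamentalFormNormSq, ← he]
  have h2 : ∀ a b, g.inner x (F.secondFundamentalForm g x (e a x) (e b x))
      (F.secondFundamentalForm g x (e a x) (e b x))
      = ∑ j, (bracketCoeff g (e a) (ε j) (e b) x + bracketCoeff g (e b) (ε j) (e a) x) ^ 2 / 4 := by
    intro a b
    rw [hc.inner_eq_sum (secondFundamentalForm_mem_normal _ _)]
    refine Finset.sum_congr rfl fun j _ => ?_
    rw [h1]
    ring
  simp only [h2, Finset.sum_div]
  rw [Finset.sum_congr rfl fun a _ => Finset.sum_comm, Finset.sum_comm]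

theorem IsAdaptedFrameAt.integrabilityTensorNormSq_eq (hg : IsSmoothMetric g)
    (h : F.IsAdaptedFrameAt g x e ε) (hε : ∀ j, ε j x = tangentBasis g x (F.normal g x) j) :
    F.integrabilityTensorNormSq g x
      = (∑ a, ∑ i, ∑ j, bracketCoeff g (ε i) (ε j) (e a) x ^ 2) / 4 := by
  have hb := h.basis_tangent.self_of_nhds
  have hc := h.basis_normal.self_of_nhds
  have h1 : ∀ i j a, g.inner x (e a x) (F.integrabilityTensor g x (ε i x) (ε j x))
      = bracketCoeff g (ε i) (ε j) (e a) x / 2 := by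
    intro i j a
    have hX := (h.smooth_tangent a).diffFieldAt
    have hXt := h.basis_tangent.mono fun y hy => hy.mem a
    rw [integrabilityTensor, map_smul, inner_tangentPart (hb.mem a), g.symm,
      inner_mlieBracket_normal hg hX hXt (diffFieldAt_normalExtend hg _)
        (.of_forall fun y => normalPart_mem _) (diffFieldAt_normalExtend hg _)
        (.of_forall fun y => normalPart_mem _), bracketCoeff,
      inner_mlieBracket_normal hg hX hXt (h.smooth_normal i).diffFieldAt
        (h.basis_normal.mono fun y hy => hy.mem i) (h.smooth_normal j).diffFieldAt
        (h.basis_normal.mono fun y hy => hy.mem j),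
      normalExtend_self (hc.mem i), normalExtend_self (hc.mem j), smul_eq_mul]
    ring
  simp only [integrabilityTensorNormSq, ← hε]
  have h2 : ∀ i j, g.inner x (F.integrabilityTensor g x (ε i x) (ε j x))
      (F.integrabilityTensor g x (ε i x) (ε j x))
      = ∑ a, bracketCoeff g (ε i) (ε j) (e a) x ^ 2 / 4 := by
    intro i j
    rw [hb.inner_eq_sum (integrabilityTensor_mem_tangent _ _)]
    refine Finset.sum_congr rfl fun a _ => ?_
    rw [h1]
    ring
  simp only [h2, Finset.sum_div]
  rw [Finset.sum_congr rfl fun i _ => Finset.sum_comm, Finset.sum_comm]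

/-- The e_a-component of H^⊥ is ∑_j A_ajj, because the tangential part of ∇_v V for normal V depends
only on the value of V. Applied with L = du. -/
theorem IsAdaptedFrameAt.map_normalMeanCurvature (hg : IsSmoothMetric g)
    (h : F.IsAdaptedFrameAt g x e ε) (hε : ∀ j, ε j x = tangentBasis g x (F.normal g x) j)
    (L : TangentSpace 𝓘(ℝ, E) x →L[ℝ] ℝ) :
    L (F.normalMeanCurvature g x)
      = ∑ a, (∑ j, bracketCoeff g (e a) (ε j) (ε j) x) * L (e a x) := by
  have hb := h.basis_tangent.self_of_nhds
  have hc := h.basis_normal.self_of_nhds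
  have h1 : ∀ a, g.inner x (e a x) (F.normalMeanCurvature g x)
      = ∑ j, bracketCoeff g (e a) (ε j) (ε j) x := by
    intro a
    rw [normalMeanCurvature, map_sum]
    refine Finset.sum_congr rfl fun j _ => ?_
    have hX := (h.smooth_tangent a).diffFieldAt
    have hXt := h.basis_tangent.mono fun y hy => hy.mem a
    rw [← hε, normalSecondFundamentalForm, map_smul, inner_tangentPart (hb.mem a), g.symm,
      map_add, add_apply, inner_leviCivita_normal hg hX hXt (diffFieldAt_normalExtend hg _)
        (.of_forall fun y => normalPart_mem _), normalExtend_self (hc.mem j),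
      ← (h.eventually_connCoeff hg).self_of_nhds.1 a j, connCoeff,
      inner_leviCivita_normal hg hX hXt (h.smooth_normal j).diffFieldAt
        (h.basis_normal.mono fun y hy => hy.mem j), smul_eq_mul]
    ring
  conv_lhs => rw [← hb.sum_eq _ normalMeanCurvature_mem_tangent]
  simp only [map_sum, map_smul, smul_eq_mul, h1]

/-- Near `x` one has g(∇^⊤u, e_a) = e_a(u). Differentiating along e_a leaves the correction g(∇^⊤u,
∇_{e_a} e_a), whose coefficients are g([e_b, e_a], e_a). -/
theorem IsAdaptedFrameAt.leafLaplacian_eq (hg : IsSmoothMetric g)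
    (h : F.IsAdaptedFrameAt g x e ε) (he : ∀ a, e a x = tangentBasis g x (F.tangent x) a)
    {u : M → ℝ} (hu : ContMDiffAt 𝓘(ℝ, E) 𝓘(ℝ, ℝ) ∞ u x) :
    F.leafLaplacian g u x
      = ∑ a, mvfderiv 𝓘(ℝ, E) (fun y => mvfderiv 𝓘(ℝ, E) u y (e a y)) x (e a x)
        - ∑ a, ∑ b, mvfderiv 𝓘(ℝ, E) u x (e b x) * bracketCoeff g (e b) (e a) (e a) x := by
  have hb := h.basis_tangent.self_of_nhds
  have hgr : F.leafGradient g u =ᶠ[𝓝 x] fun y => ∑ b, mvfderiv 𝓘(ℝ, E) u y (e b y) • e b y := by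
    filter_upwards [h.basis_tangent] with y hy using leafGradient_eq_sum hy u
  have hd : DiffFieldAt (F.leafGradient g u) x :=
    (DiffFieldAt.sum (s := Finset.univ) fun b => (h.smooth_tangent b).diffFieldAt.smul
      ((hu.mvfderiv_apply (h.smooth_tangent b)).mdifferentiableAt (by simp))).congr hgr
  simp only [leafLaplacian, ← he]
  rw [← Finset.sum_sub_distrib]
  refine Finset.sum_congr rfl fun a _ => ?_
  have h1 := mvfderiv_inner hg hd (h.smooth_tangent a).diffFieldAt (e a x)
  have h2 : (fun y => g.inner y (F.leafGradient g u y) (e a y))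
      =ᶠ[𝓝 x] fun y => mvfderiv 𝓘(ℝ, E) u y (e a y) := by
    filter_upwards [h.basis_tangent] with y hy
    rw [leafGradient_eq_sum hy]
    simp [map_sum, sum_apply, hy.inner_eq]
  rw [mvfderiv_congr_of_eventuallyEq h2, leafGradient_eq_sum hb, map_sum, sum_apply] at h1
  have h3 : ∀ b, g.inner x (e b x) (leviCivita g x (e a x) (e a))
      = bracketCoeff g (e b) (e a) (e a) x := by
    intro b
    have h4 := (h.isOrthonormalFrameAt.two_mul_connCoeff hg).self_of_nhds (.inl a) (.inl a) (.inl b)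
    simp only [Sum.elim_inl] at h4
    rw [bracketCoeff_swap (X := e a) (Y := e b)] at h4
    have h5 := bracketCoeff_swap (g := g) (X := e a) (Y := e a) (Z := e b) (x := x)
    rw [g.symm]
    change connCoeff g (e a) (e a) (e b) x = _
    linarith
  simp only [map_smul, smul_apply, smul_eq_mul, h3] at h1
  linarith

end

end Foliation

/-! ### The change of metric -/

theorem mdifferentiableAt_inv {E : Type*} [NormedAddCommGroup E] [NormedSpace ℝ E]
    {M : Type*} [TopologicalSpace M] [ChartedSpace E M] {u : M → ℝ} {x : M}
    (hu : MDifferentiableAt 𝓘(ℝ, E) 𝓘(ℝ, ℝ) u x) (h0 : u x ≠ 0) :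
    MDifferentiableAt 𝓘(ℝ, E) 𝓘(ℝ, ℝ) (fun y => (u y)⁻¹) x :=
  (differentiableAt_inv h0).mdifferentiableAt.comp x hu

theorem mvfderiv_inv {E : Type*} [NormedAddCommGroup E] [NormedSpace ℝ E]
    {M : Type*} [TopologicalSpace M] [ChartedSpace E M] {u : M → ℝ} {x : M}
    (hu : MDifferentiableAt 𝓘(ℝ, E) 𝓘(ℝ, ℝ) u x) (h0 : u x ≠ 0) (v : TangentSpace 𝓘(ℝ, E) x) :
    mvfderiv 𝓘(ℝ, E) (fun y => (u y)⁻¹) x v = - (mvfderiv 𝓘(ℝ, E) u x v / u x ^ 2) := by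
  rw [mvfderiv_comp_eq_fderiv (h := fun t : ℝ => t⁻¹) (differentiableAt_inv h0) hu, fderiv_inv]
  simp [div_eq_mul_inv]

namespace Foliation

variable {p n : ℕ} {E : Type*} [NormedAddCommGroup E] [NormedSpace ℝ E] [FiniteDimensional ℝ E]
  {M : Type*} [TopologicalSpace M] [ChartedSpace E M]
  {F : Foliation p n E M} {x : M} {g : TangentMetric E M} {u : M → ℝ} {hu : ∀ x, 0 < u x}

section

variable {X Y Z : ∀ x : M, TangentSpace 𝓘(ℝ, E) x}

theorem bracketCoeff_normalConformal_tangent (hZ : Z x ∈ F.tangent x) :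
    bracketCoeff (F.normalConformal g u hu) X Y Z x = bracketCoeff g X Y Z x := by
  rw [bracketCoeff, bracketCoeff, (F.normalConformal g u hu).symm,
    normalConformal_inner_tangent hZ, g.symm]

/-- The new metric contributes u² and the rescaled field u⁻¹. -/
theorem bracketCoeff_normalConformal_inv_smul (hZ : Z x ∈ F.normal g x) :
    bracketCoeff (F.normalConformal g u hu) X Y (fun y => (u y)⁻¹ • Z y) x
      = u x * bracketCoeff g X Y Z x := by
  have h0 := (hu x).ne'
  rw [bracketCoeff, bracketCoeff, map_smul, (F.normalConformal g u hu).symm,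
    normalConformal_inner_normal hZ, g.symm, smul_eq_mul]
  field_simp

variable [IsManifold 𝓘(ℝ, E) ∞ M]

theorem bracketCoeff_inv_smul_right (hus : MDifferentiableAt 𝓘(ℝ, E) 𝓘(ℝ, ℝ) u x) (h0 : u x ≠ 0)
    (hY : DiffFieldAt Y x) :
    bracketCoeff g X (fun y => (u y)⁻¹ • Y y) Z x
      = (u x)⁻¹ * bracketCoeff g X Y Z x
        - mvfderiv 𝓘(ℝ, E) u x (X x) / u x ^ 2 * g.inner x (Y x) (Z x) := by
  have : CompleteSpace E := FiniteDimensional.complete ℝ E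
  have h1 : mlieBracket 𝓘(ℝ, E) X (fun y => (u y)⁻¹ • Y y) x = _ :=
    mlieBracket_smul_right (f := fun y => (u y)⁻¹) (mdifferentiableAt_inv hus h0) hY
  rw [bracketCoeff, h1, mvfderiv_inv hus h0, map_add, map_smul, map_smul, add_apply, smul_apply,
    smul_apply, smul_eq_mul, smul_eq_mul, bracketCoeff]
  ring

end

variable [IsManifold 𝓘(ℝ, E) ∞ M] {ι : Type*} [Fintype ι] [DecidableEq ι] {κ : Type*} [Fintype κ]
  [DecidableEq κ] {e : ι → ∀ x : M, TangentSpace 𝓘(ℝ, E) x} {ε : κ → ∀ x : M, TangentSpace 𝓘(ℝ, E) x}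

/-- The derivative of u⁻¹ multiplies a normal field, which is orthogonal to e_b. -/
theorem IsAdaptedFrameAt.bracketCoeff_normalConformal_tangent_normal_tangent
    (h : F.IsAdaptedFrameAt g x e ε) (hus : ContMDiff 𝓘(ℝ, E) 𝓘(ℝ, ℝ) ∞ u) :
    ∀ᶠ y in 𝓝 x, ∀ a j b,
      bracketCoeff (F.normalConformal g u hu) (e a) (fun y => (u y)⁻¹ • ε j y) (e b) y
        = (u y)⁻¹ * bracketCoeff g (e a) (ε j) (e b) y := by
  have h1 : ∀ᶠ y in 𝓝 x, ∀ j, DiffFieldAt (ε j) y :=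
    Filter.eventually_all.2 fun j => (h.smooth_normal j).eventually_diffFieldAt
  filter_upwards [h.basis_tangent, h.basis_normal, h1] with y hb hc hd a j b
  rw [bracketCoeff_normalConformal_tangent (hb.mem b), bracketCoeff_inv_smul_right
    (hus.mdifferentiable (by simp) y) (hu y).ne' (hd j), inner_normal_tangent (hc.mem j) (hb.mem b)]
  ring

/-- The factors u and u⁻¹ cancel; differentiating u⁻¹ shifts the diagonal by -e_a(log u). -/
theorem IsAdaptedFrameAt.bracketCoeff_normalConformal_tangent_normal_normal
    (h : F.IsAdaptedFrameAt g x e ε) (hus : ContMDiff 𝓘(ℝ, E) 𝓘(ℝ, ℝ) ∞ u) :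
    ∀ᶠ y in 𝓝 x, ∀ a j i,
      bracketCoeff (F.normalConformal g u hu) (e a) (fun y => (u y)⁻¹ • ε j y)
          (fun y => (u y)⁻¹ • ε i y) y
        = bracketCoeff g (e a) (ε j) (ε i) y
          - if j = i then mvfderiv 𝓘(ℝ, E) u y (e a y) * (u y)⁻¹ else 0 := by
  have h1 : ∀ᶠ y in 𝓝 x, ∀ j, DiffFieldAt (ε j) y :=
    Filter.eventually_all.2 fun j => (h.smooth_normal j).eventually_diffFieldAt
  filter_upwards [h.basis_normal, h1] with y hc hd a j i
  have h0 := (hu y).ne'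
  rw [bracketCoeff_normalConformal_inv_smul (hc.mem i), bracketCoeff_inv_smul_right
    (hus.mdifferentiable (by simp) y) h0 (hd j), hc.inner_eq]
  split_ifs
  · field_simp
  · field_simp
    ring

theorem IsAdaptedFrameAt.bracketCoeff_normalConformal_normal_normal_tangent
    (h : F.IsAdaptedFrameAt g x e ε) (hus : ContMDiff 𝓘(ℝ, E) 𝓘(ℝ, ℝ) ∞ u) (i j : κ) (a : ι) :
    bracketCoeff (F.normalConformal g u hu) (fun y => (u y)⁻¹ • ε i y)
        (fun y => (u y)⁻¹ • ε j y) (e a) x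
      = (u x)⁻¹ ^ 2 * bracketCoeff g (ε i) (ε j) (e a) x := by
  have hb := h.basis_tangent.self_of_nhds
  have hc := h.basis_normal.self_of_nhds
  have hd := hus.mdifferentiable (by simp) x
  rw [bracketCoeff_normalConformal_tangent (hb.mem a), bracketCoeff_inv_smul_right hd (hu x).ne'
    (h.smooth_normal j).diffFieldAt, bracketCoeff_swap, bracketCoeff_inv_smul_right hd (hu x).ne'
    (h.smooth_normal i).diffFieldAt, inner_normal_tangent (hc.mem j) (hb.mem a),
    inner_normal_tangent (hc.mem i) (hb.mem a), bracketCoeff_swap (X := ε j)]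
  ring

/-- The effect of a conformal change of the metric along the normal distribution on the mixed scalar
curvature of a harmonic foliation, in an adapted frame. -/
theorem IsAdaptedFrameAt.mixedScalarCurvature_normalConformal (hg : IsSmoothMetric g)
    (h : F.IsAdaptedFrameAt g x e ε)
    (hmin : ∀ᶠ y in 𝓝 x, ∀ j, ∑ a, bracketCoeff g (e a) (ε j) (e a) y = 0)
    (hus : ContMDiff 𝓘(ℝ, E) 𝓘(ℝ, ℝ) ∞ u) :
    (F.mixedScalarCurvature g x - F.mixedScalarCurvature (F.normalConformal g u hu) x) * u x
      = Fintype.card κ *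
          (∑ a, mvfderiv 𝓘(ℝ, E) (fun y => mvfderiv 𝓘(ℝ, E) u y (e a y)) x (e a x)
            - ∑ a, ∑ b, mvfderiv 𝓘(ℝ, E) u x (e b x) * bracketCoeff g (e b) (e a) (e a) x)
        - 2 * ∑ a, (∑ j, bracketCoeff g (e a) (ε j) (ε j) x) * mvfderiv 𝓘(ℝ, E) u x (e a x)
        + (∑ j, ∑ a, ∑ b, (bracketCoeff g (e a) (ε j) (e b) x
            + bracketCoeff g (e b) (ε j) (e a) x) ^ 2) / 4 * ((u x)⁻¹ - u x)
        - (∑ a, ∑ i, ∑ j, bracketCoeff g (ε i) (ε j) (e a) x ^ 2) / 4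
          * (u x ^ (-3 : ℤ) - u x) := by
  have h0 := (hu x).ne'
  have hb := h.basis_tangent.self_of_nhds
  have hud := hus.mdifferentiable (by simp) x
  have hα := h.bracketCoeff_normalConformal_tangent_normal_tangent (hu := hu) hus
  have hA := h.bracketCoeff_normalConformal_tangent_normal_normal (hu := hu) hus
  have hτ := h.bracketCoeff_normalConformal_normal_normal_tangent (hu := hu) hus
  have hγ : ∀ b a, bracketCoeff (F.normalConformal g u hu) (e b) (e a) (e a) x
      = bracketCoeff g (e b) (e a) (e a) x :=
    fun b a => bracketCoeff_normalConformal_tangent (hb.mem a)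
  -- The leaves are minimal for the new metric as well, so the same curvature formula applies to it.
  have hmin' : ∀ᶠ y in 𝓝 x, ∀ j, ∑ a, bracketCoeff (F.normalConformal g u hu) (e a)
      (fun y => (u y)⁻¹ • ε j y) (e a) y = 0 := by
    filter_upwards [hα, hmin] with y hy hm j
    simp only [hy, ← Finset.mul_sum, hm, mul_zero]
  have hdA : ∀ a j, mvfderiv 𝓘(ℝ, E) (bracketCoeff (F.normalConformal g u hu) (e a)
        (fun y => (u y)⁻¹ • ε j y) (fun y => (u y)⁻¹ • ε j y)) x (e a x)
      = mvfderiv 𝓘(ℝ, E) (bracketCoeff g (e a) (ε j) (ε j)) x (e a x)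
        - (mvfderiv 𝓘(ℝ, E) (fun y => mvfderiv 𝓘(ℝ, E) u y (e a y)) x (e a x) * (u x)⁻¹
          - (mvfderiv 𝓘(ℝ, E) u x (e a x) * (u x)⁻¹) ^ 2) := by
    intro a j
    have h1 : bracketCoeff (F.normalConformal g u hu) (e a)
        (fun y => (u y)⁻¹ • ε j y) (fun y => (u y)⁻¹ • ε j y) =ᶠ[𝓝 x] fun y =>
        bracketCoeff g (e a) (ε j) (ε j) y - mvfderiv 𝓘(ℝ, E) u y (e a y) * (u y)⁻¹ := by
      filter_upwards [hA] with y hy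
      rw [hy, if_pos rfl]
    have h2 : MDifferentiableAt 𝓘(ℝ, E) 𝓘(ℝ, ℝ) (bracketCoeff g (e a) (ε j) (ε j)) x :=
      hg.mdifferentiableAt ((h.smooth_tangent a).mlieBracket (h.smooth_normal j)).diffFieldAt
        (h.smooth_normal j).diffFieldAt
    have h3 : MDifferentiableAt 𝓘(ℝ, E) 𝓘(ℝ, ℝ) (fun y => mvfderiv 𝓘(ℝ, E) u y (e a y)) x :=
      (hus.contMDiffAt.mvfderiv_apply (h.smooth_tangent a)).mdifferentiableAt (by simp)
    have h4 : MDifferentiableAt 𝓘(ℝ, E) 𝓘(ℝ, ℝ) (fun y => (u y)⁻¹) x := mdifferentiableAt_inv hud h0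
    have h5 : MDifferentiableAt 𝓘(ℝ, E) 𝓘(ℝ, ℝ)
      (fun y => mvfderiv 𝓘(ℝ, E) u y (e a y) * (u y)⁻¹) x := h3.mul h4
    rw [mvfderiv_congr_of_eventuallyEq h1, mvfderiv_fun_sub h2 h5, sub_apply,
      mvfderiv_fun_mul h3 h4, add_apply, smul_apply, smul_apply, mvfderiv_inv hud h0, smul_eq_mul,
      smul_eq_mul]
    field_simp
    ring
  rw [h.mixedScalarCurvature_eq hg hmin, (h.normalConformal hus hu).mixedScalarCurvature_eq
    (isSmoothMetric_normalConformal hg hus hu) hmin']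
  simp only [hdA, hα.self_of_nhds, hA.self_of_nhds, hτ, hγ, if_true]
  have q1 : ∑ a, ∑ j, (mvfderiv 𝓘(ℝ, E) (bracketCoeff g (e a) (ε j) (ε j)) x (e a x)
        - (mvfderiv 𝓘(ℝ, E) (fun y => mvfderiv 𝓘(ℝ, E) u y (e a y)) x (e a x) * (u x)⁻¹
          - (mvfderiv 𝓘(ℝ, E) u x (e a x) * (u x)⁻¹) ^ 2))
      = ∑ a, ∑ j, mvfderiv 𝓘(ℝ, E) (bracketCoeff g (e a) (ε j) (ε j)) x (e a x)
        - Fintype.card κ *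
          ((∑ a, mvfderiv 𝓘(ℝ, E) (fun y => mvfderiv 𝓘(ℝ, E) u y (e a y)) x (e a x)) * (u x)⁻¹
            - ∑ a, (mvfderiv 𝓘(ℝ, E) u x (e a x) * (u x)⁻¹) ^ 2) := by
    simp only [Finset.sum_sub_distrib, Finset.sum_const, Finset.card_univ, nsmul_eq_mul,
      Finset.mul_sum, Finset.sum_mul, mul_sub]
  have q2 : ∑ a, ∑ b, (∑ j, (bracketCoeff g (e b) (ε j) (ε j) x
        - mvfderiv 𝓘(ℝ, E) u x (e b x) * (u x)⁻¹)) * bracketCoeff g (e b) (e a) (e a) x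
      = ∑ a, ∑ b, (∑ j, bracketCoeff g (e b) (ε j) (ε j) x) * bracketCoeff g (e b) (e a) (e a) x
        - Fintype.card κ * (u x)⁻¹
          * ∑ a, ∑ b, mvfderiv 𝓘(ℝ, E) u x (e b x) * bracketCoeff g (e b) (e a) (e a) x := by
    simp only [Finset.sum_sub_distrib, Finset.sum_const, Finset.card_univ, nsmul_eq_mul, sub_mul]
    simp only [Finset.mul_sum]
    congr 1
    exact Finset.sum_congr rfl fun a _ => Finset.sum_congr rfl fun b _ => by ring
  have q3 : ∑ j, ∑ a, ∑ b, ((u x)⁻¹ * bracketCoeff g (e a) (ε j) (e b) x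
        + (u x)⁻¹ * bracketCoeff g (e b) (ε j) (e a) x) ^ 2
      = (u x)⁻¹ ^ 2 * ∑ j, ∑ a, ∑ b, (bracketCoeff g (e a) (ε j) (e b) x
        + bracketCoeff g (e b) (ε j) (e a) x) ^ 2 := by
    simp only [← mul_add, mul_pow, Finset.mul_sum]
  have q4 : ∑ a, ∑ i, ∑ j, ((u x)⁻¹ ^ 2 * bracketCoeff g (ε i) (ε j) (e a) x) ^ 2
      = (u x)⁻¹ ^ 4 * ∑ a, ∑ i, ∑ j, bracketCoeff g (ε i) (ε j) (e a) x ^ 2 := by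
    simp only [mul_pow, Finset.mul_sum, ← pow_mul]
  -- The change in 4 ‖h^⊥‖²: only diagonal entries are affected, giving a multiple of H^⊥(u) and a
  -- squared gradient. Divided by 4, the latter cancels the squared gradient in `q1`.
  have q5 : ∑ a, ∑ i, ∑ j, (bracketCoeff g (e a) (ε i) (ε j) x
          - (if i = j then mvfderiv 𝓘(ℝ, E) u x (e a x) * (u x)⁻¹ else 0)
        + (bracketCoeff g (e a) (ε j) (ε i) x
          - if j = i then mvfderiv 𝓘(ℝ, E) u x (e a x) * (u x)⁻¹ else 0)) ^ 2
      = ∑ a, ∑ i, ∑ j, (bracketCoeff g (e a) (ε i) (ε j) x + bracketCoeff g (e a) (ε j) (ε i) x) ^ 2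
        - 8 * (u x)⁻¹ * ∑ a, (∑ j, bracketCoeff g (e a) (ε j) (ε j) x)
          * mvfderiv 𝓘(ℝ, E) u x (e a x)
        + 4 * (Fintype.card κ * ∑ a, (mvfderiv 𝓘(ℝ, E) u x (e a x) * (u x)⁻¹) ^ 2) := by
    have h1 : ∀ a i j, (bracketCoeff g (e a) (ε i) (ε j) x
          - (if i = j then mvfderiv 𝓘(ℝ, E) u x (e a x) * (u x)⁻¹ else 0)
        + (bracketCoeff g (e a) (ε j) (ε i) x
          - if j = i then mvfderiv 𝓘(ℝ, E) u x (e a x) * (u x)⁻¹ else 0)) ^ 2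
        = (bracketCoeff g (e a) (ε i) (ε j) x + bracketCoeff g (e a) (ε j) (ε i) x) ^ 2
          - (if i = j then 8 * (u x)⁻¹ * (bracketCoeff g (e a) (ε i) (ε i) x
            * mvfderiv 𝓘(ℝ, E) u x (e a x)) else 0)
          + if i = j then 4 * (mvfderiv 𝓘(ℝ, E) u x (e a x) * (u x)⁻¹) ^ 2 else 0 := by
      intro a i j
      rcases eq_or_ne i j with rfl | hij
      · simp only [if_true]
        ring
      · simp only [if_neg hij, if_neg hij.symm]
        ring
    simp only [h1, Finset.sum_add_distrib, Finset.sum_sub_distrib, Finset.sum_ite_eq,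
      Finset.mem_univ, if_true, Finset.sum_const, Finset.card_univ, nsmul_eq_mul, Finset.sum_mul,
      Finset.mul_sum]
    congr 1
    exact Finset.sum_congr rfl fun a _ => by ring
  rw [q1, q2, q3, q4, q5, zpow_neg]
  norm_cast
  field_simp
  ring

end Foliation

/-! ### Leafwise constant functions and the conclusion -/

/-- The functions e_a(u) vanish near `x`, hence so do their derivatives. -/
theorem Foliation.IsLeafwiseConstant.leafLaplacian_eq_zero {p n : ℕ} {E : Type*}
    [NormedAddCommGroup E] [NormedSpace ℝ E] [FiniteDimensional ℝ E]
    {M : Type*} [TopologicalSpace M] [ChartedSpace E M] [IsManifold 𝓘(ℝ, E) ∞ M]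
    {F : Foliation p n E M} {g : TangentMetric E M} {u : M → ℝ} (h : F.IsLeafwiseConstant u)
    (hg : IsSmoothMetric g) (hu : ContMDiff 𝓘(ℝ, E) 𝓘(ℝ, ℝ) ∞ u) (x : M) :
    F.leafLaplacian g u x = 0 := by
  obtain ⟨e, ε, hf, he, -⟩ := Foliation.exists_isAdaptedFrameAt hg F x
  have h1 : ∀ a, (fun y => mvfderiv 𝓘(ℝ, E) u y (e a y)) =ᶠ[𝓝 x] fun _ => (0 : ℝ) := by
    intro a
    filter_upwards [hf.basis_tangent] with y hy
      using h.mvfderiv_eq_zero (hu.mdifferentiable (by simp) y) (hy.mem a)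
  have h2 : ∀ a, mvfderiv 𝓘(ℝ, E) u x (e a x) = 0 := fun a => (h1 a).self_of_nhds
  rw [hf.leafLaplacian_eq hg he hu.contMDiffAt]
  simp only [h2, zero_mul, Finset.sum_const_zero, sub_zero]
  refine Finset.sum_eq_zero fun a _ => ?_
  rw [mvfderiv_congr_of_eventuallyEq (h1 a), mvfderiv_const, zero_apply]

theorem proposition2 {E : Type*} [NormedAddCommGroup E] [NormedSpace ℝ E] [FiniteDimensional ℝ E]
    {M : Type*} [TopologicalSpace M] [T2Space M] [SecondCountableTopology M] [ChartedSpace E M]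
    [IsManifold 𝓘(ℝ, E) ∞ M] {p n : ℕ} (F : Foliation p n E M)
    (g : ContMDiffRiemannianMetric 𝓘(ℝ, E) ∞ E (fun x : M => TangentSpace 𝓘(ℝ, E) x))
    (hF : F.IsHarmonic g.toRiemannianMetric)
    (u : M → ℝ) (hu : ContMDiff 𝓘(ℝ, E) 𝓘(ℝ, ℝ) ∞ u) (hu_pos : ∀ x, 0 < u x) :
    (∀ x, (F.mixedScalarCurvature g.toRiemannianMetric x
          - F.mixedScalarCurvature (F.normalConformal g.toRiemannianMetric u hu_pos) x) * u x
        = n * F.leafLaplacian g.toRiemannianMetric u x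
          - 2 * mvfderiv 𝓘(ℝ, E) u x (F.normalMeanCurvature g.toRiemannianMetric x)
          + F.secondFundamentalFormNormSq g.toRiemannianMetric x * ((u x)⁻¹ - u x)
          - F.integrabilityTensorNormSq g.toRiemannianMetric x * (u x ^ (-3 : ℤ) - u x)) ∧
    (F.IsLeafwiseConstant u →
      ∀ x, F.mixedScalarCurvature (F.normalConformal g.toRiemannianMetric u hu_pos) x
        = F.mixedScalarCurvature g.toRiemannianMetric x
          - (u x ^ (-2 : ℤ) - 1) * F.secondFundamentalFormNormSq g.toRiemannianMetric x
          + (u x ^ (-4 : ℤ) - 1) * F.integrabilityTensorNormSq g.toRiemannianMetric x) := by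
  set G := g.toRiemannianMetric
  have hg : IsSmoothMetric G := isSmoothMetric_toRiemannianMetric g
  have key : ∀ x, (F.mixedScalarCurvature G x
      - F.mixedScalarCurvature (F.normalConformal G u hu_pos) x) * u x
      = n * F.leafLaplacian G u x - 2 * mvfderiv 𝓘(ℝ, E) u x (F.normalMeanCurvature G x)
        + F.secondFundamentalFormNormSq G x * ((u x)⁻¹ - u x)
        - F.integrabilityTensorNormSq G x * (u x ^ (-3 : ℤ) - u x) := by
    intro x
    obtain ⟨e, ε, h, he, hε⟩ := Foliation.exists_isAdaptedFrameAt hg F x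
    have hn : Fintype.card (Fin (Module.finrank ℝ (F.normal G x))) = n := by
      rw [Fintype.card_fin, F.finrank_normal]
    rw [h.mixedScalarCurvature_normalConformal hg (h.sum_bracketCoeff_of_isHarmonic hg hF) hu,
      h.secondFundamentalFormNormSq_eq hg he, h.integrabilityTensorNormSq_eq hg hε,
      h.leafLaplacian_eq hg he hu.contMDiffAt, h.map_normalMeanCurvature hg hε, hn]
  refine ⟨key, fun hc x => ?_⟩
  have h1 := key x
  -- H^⊥ is tangent to the leaves, so du kills it; dividing the remaining identity by u lowers each
  -- exponent by one.
  rw [hc.leafLaplacian_eq_zero hg hu, hc.mvfderiv_eq_zero (hu.mdifferentiable (by simp) x)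
    Foliation.normalMeanCurvature_mem_tangent, mul_zero, mul_zero, sub_zero,
    zero_add] at h1
  have h0 := (hu_pos x).ne'
  rw [zpow_neg] at h1 ⊢
  rw [zpow_neg]
  norm_cast at h1 ⊢
  field_simp at h1 ⊢
  linarith
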